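/- Let $k$ be a field of characteristic $0$, let $X/k$ be a reduced scheme locally of finite type, $M$ a locally free $\mathcal O_X$-module of finite rank, and $V$ a finite-dimensional $k$-subspace of $\Gamma(X,M)$. Let $\Delta\colon X\to X\times_k X$ be the diagonal, $I_\Delta$ the kernel of $\Delta^{-1}\mathcal O_{X\times_k X}\to\mathcal O_X$, $\mathcal P^n_{X/k}=\Delta^{-1}\mathcal O_{X\times_k X}/I_\Delta^{n+1}$ (for $n\ge 0$) the sheaf of principal parts, and $\mathcal P^n_{X/k}(M)=\mathcal P^n_{X/k}\otimes_{\mathcal O_X}M$, where the tensor product uses the right $\mathcal O_X$-structure of $\mathcal P^n_{X/k}$ (second projection) and the result is an $\mathcal O_X$-module through the left one (first projection). For $x\in X$ with residue field $k_x$, let $$d^n_V(x)\colon k_x\otimes_k V\to k_x\otimes_{\mathcal O_{X,x}}\mathcal P^n_{X/k}(M)_x$$ be the map of fibres at $x$ of the Taylor map $\mathcal O_X\otimes_k V\to\mathcal P^n_{X/k}(M)$, $\varphi\otimes v\mapsto\varphi\cdot(1\otimes v)$. Say that $V$ is separated if for each $x\in X$ there is an integer $N$ such that $d^n_V(x)$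 is injective for all $n\ge N$. Let $n_{inj}(x)\in\mathbb N\cup\{\infty\}$ be the smallest $n$ such that $d^n_V(x)$ is injective, and let $n_{inj}(V)=\sup_{x\in X}n_{inj}(x)$ be the injectivity order of $V$. 1. If $X$ is quasi-compact (equivalently, noetherian) and $V$ is separated, then $n_{inj}(V)<\infty$. 2. If $k$ is algebraically closed and $V$ injects into each stalk $M_x$, $x\in X$, then $V$ is separated. -/

import Mathlib

open CategoryTheory AlgebraicGeometry TensorProduct

universe u

noncomputable section

namespace TaylorMap

/-- An `𝒪_X`-module is locally free of finite rank if every point has an open neighbourhood `U`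
on which it is isomorphic to `𝒪_U ^ r` for some natural number `r`. -/
def IsLocallyFreeOfFiniteRank {X : Scheme.{u}} (M : X.Modules) : Prop :=
  ∀ x : X, ∃ U : X.Opens, x ∈ U ∧ ∃ r : ℕ, Nonempty (M.restrict U.ι ≅
    (SheafOfModules.free (R := U.toScheme.ringCatSheaf) (ULift.{u} (Fin r)) : U.toScheme.Modules))

variable {k : Type u} [Field k] {X : Scheme.{u}} (f : X ⟶ Spec (CommRingCat.of k))

/-- The structure map `k → Γ(X, 𝒪_X)` of a `k`-scheme `f : X ⟶ Spec k`. -/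
def structureMap : k →+* Γ(X, ⊤) :=
  f.appTop.hom.comp (Scheme.ΓSpecIso (CommRingCat.of k)).inv.hom

/-- `Γ(X, M)` for an `𝒪_X`-module `M` on a `k`-scheme `X`, as a `k`-vector space. -/
def GlobalSections (_f : X ⟶ Spec (CommRingCat.of k)) (M : X.Modules) : Type u := Γ(M, ⊤)

instance (M : X.Modules) : AddCommGroup (GlobalSections f M) :=
  inferInstanceAs (AddCommGroup Γ(M, ⊤))

instance (M : X.Modules) : Module Γ(X, ⊤) (GlobalSections f M) :=
  inferInstanceAs (Module Γ(X, ⊤) Γ(M, ⊤))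

instance (M : X.Modules) : Module k (GlobalSections f M) :=
  Module.compHom _ (structureMap f)

/-- The local ring `𝒪_x` of a point `x` of a `k`-scheme, as a `k`-algebra. -/
def StalkRing (_f : X ⟶ Spec (CommRingCat.of k)) (x : X) : Type u := X.presheaf.stalk x

instance (x : X) : CommRing (StalkRing f x) :=
  inferInstanceAs (CommRing (X.presheaf.stalk x))

instance (x : X) : IsLocalRing (StalkRing f x) :=
  inferInstanceAs (IsLocalRing (X.presheaf.stalk x))

/-- The germ at `x` of a global function. -/
def germRing (x : X) : Γ(X, ⊤) →+* StalkRing f x :=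
  (X.presheaf.germ ⊤ x trivial).hom

instance (x : X) : Algebra k (StalkRing f x) :=
  ((germRing f x).comp (structureMap f)).toAlgebra

/-- The residue field `k_x`. -/
abbrev ResidueField (x : X) : Type u := IsLocalRing.ResidueField (StalkRing f x)

/-- The stalk `M_x`, as a module over `𝒪_x`. -/
def StalkModule (_f : X ⟶ Spec (CommRingCat.of k)) (M : X.Modules) (x : X) : Type u :=
  M.presheaf.stalk x

instance (M : X.Modules) (x : X) : AddCommGroup (StalkModule f M x) :=
  inferInstanceAs (AddCommGroup (M.presheaf.stalk x))

instance (M : X.Modules) (x : X) : Module (StalkRing f x) (StalkModule f M x) :=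
  PresheafOfModules.instModuleCarrierStalkCommRingCatCarrierAbPresheafOpensCarrier
    (R := X.presheaf) M.val x

/-- The germ at `x` of a global section of `M`. -/
def germ (M : X.Modules) (x : X) : GlobalSections f M →+ StalkModule f M x :=
  (M.presheaf.germ ⊤ x trivial).hom

theorem germ_smul (M : X.Modules) (x : X) (r : Γ(X, ⊤)) (m : GlobalSections f M) :
    germ f M x (r • m) = germRing f x r • germ f M x m :=
  PresheafOfModules.germ_smul (R := X.presheaf) M.val x ⊤ trivial r m

/-- The stalk at `x` of `Δ⁻¹ 𝒪_{X ×ₖ X}`, that is, the local ring of `X ×ₖ X` at `Δ(x)`, where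
`Δ : X ⟶ X ×ₖ X` is the diagonal. -/
abbrev DiagonalStalk (x : X) : Type u :=
  (Limits.pullback f f).presheaf.stalk (Limits.pullback.diagonal f x)

/-- The stalk at `x` of the ideal sheaf `I_Δ`, the kernel of `Δ⁻¹ 𝒪_{X ×ₖ X} → 𝒪_X`. -/
def diagonalIdeal (x : X) : Ideal (DiagonalStalk f x) :=
  RingHom.ker ((Limits.pullback.diagonal f).stalkMap x).hom

/-- The stalk at `x` of the sheaf of principal parts `𝒫ⁿ_{X/k} = Δ⁻¹ 𝒪_{X ×ₖ X} / I_Δ ^ (n + 1)`. -/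
def PrincipalParts (n : ℕ) (x : X) : Type u :=
  DiagonalStalk f x ⧸ diagonalIdeal f x ^ (n + 1)

instance (n : ℕ) (x : X) : CommRing (PrincipalParts f n x) :=
  inferInstanceAs (CommRing (DiagonalStalk f x ⧸ diagonalIdeal f x ^ (n + 1)))

/-- For a retraction `p : X ×ₖ X ⟶ X` of the diagonal (one of the two projections), the map on stalks
`𝒪_x → 𝒪_{X ×ₖ X, Δ(x)}`. -/
def coprojection (p : Limits.pullback f f ⟶ X) (hp : Limits.pullback.diagonal f ≫ p = 𝟙 X) (x : X) :
    StalkRing f x →+* DiagonalStalk f x :=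
  (X.presheaf.stalkSpecializes (specializes_of_eq
      (show p (Limits.pullback.diagonal f x) = x by
        rw [← Scheme.Hom.comp_apply, hp]; rfl)) ≫
    p.stalkMap (Limits.pullback.diagonal f x)).hom

theorem coprojection_germRing (p : Limits.pullback f f ⟶ X)
    (hp : Limits.pullback.diagonal f ≫ p = 𝟙 X) (x : X) (r : Γ(X, ⊤)) :
    coprojection f p hp x (germRing f x r) =
      (Limits.pullback f f).presheaf.germ ⊤ (Limits.pullback.diagonal f x) trivial
        (p.appTop r) := by
  unfold coprojection
  change (p.stalkMap _).hom ((X.presheaf.stalkSpecializes _).hom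
    ((X.presheaf.germ ⊤ x trivial).hom r)) = _
  have h := X.presheaf.germ_stalkSpecializes (U := ⊤) (y := x)
    (x := p (Limits.pullback.diagonal f x)) trivial (specializes_of_eq
      (show p (Limits.pullback.diagonal f x) = x by
        rw [← Scheme.Hom.comp_apply, hp]; rfl))
  have h' := congr($(h).hom r)
  simp only [CommRingCat.hom_comp, RingHom.comp_apply] at h'
  rw [h']
  exact Scheme.Hom.germ_stalkMap_apply p ⊤ (Limits.pullback.diagonal f x) trivial r

/-- The left `𝒪_x`-algebra structure of `𝒫ⁿ_{X/k,x}`, through the first projection. -/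
def left (n : ℕ) (x : X) : StalkRing f x →+* PrincipalParts f n x :=
  (Ideal.Quotient.mk _).comp
    (coprojection f (Limits.pullback.fst f f) (Limits.pullback.diagonal_fst f) x)

/-- The right `𝒪_x`-algebra structure of `𝒫ⁿ_{X/k,x}`, through the second projection. -/
def right (n : ℕ) (x : X) : StalkRing f x →+* PrincipalParts f n x :=
  (Ideal.Quotient.mk _).comp
    (coprojection f (Limits.pullback.snd f f) (Limits.pullback.diagonal_snd f) x)

theorem left_algebraMap (n : ℕ) (x : X) (c : k) :
    left f n x (algebraMap k (StalkRing f x) c) = right f n x (algebraMap k (StalkRing f x) c) := by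
  have h : (Limits.pullback.fst f f).appTop (structureMap f c) = (Limits.pullback.snd f f).appTop (structureMap f c) := by
    have := congr($(congr(Scheme.Hom.appTop $(Limits.pullback.condition (f := f) (g := f)))).hom
      ((Scheme.ΓSpecIso (CommRingCat.of k)).inv.hom c))
    rw [Scheme.Hom.comp_appTop, Scheme.Hom.comp_appTop] at this
    exact this
  change Ideal.Quotient.mk _ (coprojection f _ _ x (germRing f x (structureMap f c))) =
    Ideal.Quotient.mk _ (coprojection f _ _ x (germRing f x (structureMap f c)))
  rw [coprojection_germRing, coprojection_germRing, h]

/-- `𝒫ⁿ_{X/k,x}` as an `𝒪_x`-algebra through the right structure; it is the one used to form the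
tensor product `𝒫ⁿ_{X/k,x} ⊗ M_x` below. -/
instance (n : ℕ) (x : X) : Algebra (StalkRing f x) (PrincipalParts f n x) :=
  (right f n x).toAlgebra

/-- The stalk at `x` of `𝒫ⁿ_{X/k}(M) = 𝒫ⁿ_{X/k} ⊗ M`, the tensor product over `𝒪_X` being formed
with the right structure of `𝒫ⁿ_{X/k}`. -/
def PrincipalPartsModule (n : ℕ) (M : X.Modules) (x : X) : Type u :=
  PrincipalParts f n x ⊗[StalkRing f x] StalkModule f M x

instance (n : ℕ) (M : X.Modules) (x : X) : AddCommGroup (PrincipalPartsModule f n M x) :=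
  inferInstanceAs (AddCommGroup (PrincipalParts f n x ⊗[StalkRing f x] StalkModule f M x))

instance (n : ℕ) (M : X.Modules) (x : X) :
    Module (PrincipalParts f n x) (PrincipalPartsModule f n M x) :=
  inferInstanceAs (Module (PrincipalParts f n x)
    (PrincipalParts f n x ⊗[StalkRing f x] StalkModule f M x))

/-- `𝒫ⁿ_{X/k}(M)_x` is an `𝒪_x`-module through the left structure of `𝒫ⁿ_{X/k,x}`. -/
instance (n : ℕ) (M : X.Modules) (x : X) :
    Module (StalkRing f x) (PrincipalPartsModule f n M x) :=
  Module.compHom _ (left f n x)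

instance (n : ℕ) (M : X.Modules) (x : X) : Module k (PrincipalPartsModule f n M x) :=
  Module.compHom _ (algebraMap k (StalkRing f x))

instance (n : ℕ) (M : X.Modules) (x : X) :
    IsScalarTower k (StalkRing f x) (PrincipalPartsModule f n M x) :=
  IsScalarTower.of_algebraMap_smul fun _ _ => rfl

/-- The map `Γ(X, M) → 𝒫ⁿ_{X/k}(M)_x`, `v ↦ 1 ⊗ v_x`. -/
def jet (n : ℕ) (M : X.Modules) (x : X) :
    GlobalSections f M →ₗ[k] PrincipalPartsModule f n M x where
  toFun v := (1 : PrincipalParts f n x) ⊗ₜ[StalkRing f x] germ f M x v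
  map_add' v w := by
    rw [map_add]
    exact TensorProduct.tmul_add _ _ _
  map_smul' c v := by
    change (1 : PrincipalParts f n x) ⊗ₜ[StalkRing f x] germ f M x (structureMap f c • v) =
      left f n x (algebraMap k (StalkRing f x) c) •
        ((1 : PrincipalParts f n x) ⊗ₜ[StalkRing f x] germ f M x v)
    rw [germ_smul, left_algebraMap, ← TensorProduct.smul_tmul, TensorProduct.smul_tmul']
    congr 1

variable {M : X.Modules} (V : Submodule k (GlobalSections f M))

/-- The `n`th Taylor map on stalks at `x`,
`𝒪_x ⊗ₖ V → 𝒫ⁿ_{X/k}(M)_x`, `φ ⊗ v ↦ φ • (1 ⊗ v_x)`. -/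
def taylorStalk (n : ℕ) (x : X) :
    StalkRing f x ⊗[k] V →ₗ[StalkRing f x] PrincipalPartsModule f n M x :=
  ((jet f n M x).comp V.subtype).liftBaseChange (StalkRing f x)

/-- The `n`th Taylor map on fibres at `x`, `k_x ⊗ₖ V → k_x ⊗_{𝒪_x} 𝒫ⁿ_{X/k}(M)_x`: the base change
to `k_x` of the map on stalks, where `k_x ⊗_{𝒪_x} (𝒪_x ⊗ₖ V) = k_x ⊗ₖ V`. -/
def taylorFibre (n : ℕ) (x : X) :
    ResidueField f x ⊗[k] V →ₗ[ResidueField f x]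
      ResidueField f x ⊗[StalkRing f x] PrincipalPartsModule f n M x :=
  (taylorStalk f V n x).baseChange (ResidueField f x) ∘ₗ
    (AlgebraTensorModule.cancelBaseChange k (StalkRing f x) (ResidueField f x)
      (ResidueField f x) V).symm.toLinearMap

/-- `V` is separated at `x`: the Taylor map on fibres at `x` is injective for all large `n`. -/
def IsSeparatedAt (x : X) : Prop :=
  ∃ N : ℕ, ∀ n : ℕ, N ≤ n → Function.Injective (taylorFibre f V n x)

/-- `V` is separated (on `X`): it is separated at each point of `X`. -/
def IsSeparatedSubspace : Prop :=
  ∀ x : X, IsSeparatedAt f V x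

/-- The injectivity order of `V` at `x`: the smallest `n` such that the Taylor map on fibres at `x`
is injective, and `⊤` if there is none. -/
def injectivityOrderAt (x : X) : ℕ∞ :=
  sInf {m : ℕ∞ | ∃ n : ℕ, m = n ∧ Function.Injective (taylorFibre f V n x)}

/-- The injectivity order of `V`. -/
def injectivityOrder : ℕ∞ :=
  ⨆ x : X, injectivityOrderAt f V x

end TaylorMap

end

/-! Near a point `x` the module is a retract of a free module on an affine open subset with ring
`A`, so elements of `V` have coordinates in `A`. With `κ = k_x`, the fibre at `x` of the principal
parts is `(κ ⊗ A) / m ^ (n + 1)`, where `m` is the ideal of the rational point of `X_κ` defined by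
`x`. Hence the Taylor map at `x` is injective exactly when no nonzero `t` in `κ ⊗ V` has all its
coordinates in `m ^ (n + 1)`. This is `JetInjective`, and `injective_taylorFibre_iff` is the
translation; it rests on two one-sided comparisons, so that the local ring of `X ×ₖ X` on the
diagonal need not be computed.

Finiteness of the order: `(A ⊗ A) / I ^ (n + 1)` is a finite `A`-module. A left inverse of the jet
map at `x` therefore becomes, after multiplication by one function `s` with `s(x) ≠ 0`, a family of
functionals with values in `A / p`, where `p` is the prime of `x`. These specialize to every point
of the closure of `x` where `s` does not vanish, and the same `n` works there
(`JetInjective.exists_spread`). Noetherian induction turns the pointwise bounds into a uniform one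
(`exists_uniform_bound`).

Separatedness: the kernels of the jet maps decrease in the finite-dimensional space `κ ⊗ V`, hence
stabilize. By Krull's intersection theorem the coordinates of an element of the limit kernel are
killed by some `1 - r` with `r ∈ m`. Over an algebraically closed field `κ ⊗ O / P` is a domain for
every prime `P` of the local ring `O`, and `1 - r` is nonzero in it because `P` lies in the maximal
ideal. As `O` is reduced, `1 - r` is a nonzerodivisor, the coordinates vanish, and injectivity of
`V` into the stalk gives `t = 0` (`exists_forall_jetInjective`). -/

noncomputable section

namespace TaylorMap

/-! ### Jets at a field-valued point of an algebra -/

section JetCriterion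

variable {k A κ V ι : Type*} [Field k] [CommRing A] [Algebra k A] [Field κ] [Algebra k κ]
  [AddCommGroup V] [Module k V]

/-- The evaluation `κ ⊗ₖ A → κ` at a `κ`-valued point of `A`. -/
def evalPoint (ε : A →ₐ[k] κ) : κ ⊗[k] A →ₐ[κ] κ :=
  Algebra.TensorProduct.lift (AlgHom.id κ κ) ε fun _ _ => Commute.all _ _

@[simp]
theorem evalPoint_tmul (ε : A →ₐ[k] κ) (c : κ) (a : A) : evalPoint ε (c ⊗ₜ a) = c * ε a := by
  simp [evalPoint]

/-- The ideal of `κ ⊗ₖ A` of the rational point defined by a `κ`-valued point of `A`. -/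
def pointIdeal (ε : A →ₐ[k] κ) : Ideal (κ ⊗[k] A) := RingHom.ker (evalPoint ε)

/-- The `n`-jets at a `κ`-valued point of the elements of `V`, mapped to `A ^ ι` by `φ`, are
linearly independent over `κ` as far as the elements of `V` are. -/
def JetInjective (ε : A →ₐ[k] κ) (φ : ι → V →ₗ[k] A) (n : ℕ) : Prop :=
  ∀ t : κ ⊗[k] V, (∀ j, (φ j).baseChange κ t ∈ pointIdeal ε ^ (n + 1)) → t = 0

theorem JetInjective.mono {ε : A →ₐ[k] κ} {φ : ι → V →ₗ[k] A} {n m : ℕ}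
    (h : JetInjective ε φ n) (hnm : n ≤ m) : JetInjective ε φ m :=
  fun t ht => h t fun j => Ideal.pow_le_pow_right (by omega) (ht j)

/-- The canonical map `A ⊗ₖ A → κ ⊗ₖ A`. -/
def mapLeft (ε : A →ₐ[k] κ) : A ⊗[k] A →ₐ[k] κ ⊗[k] A :=
  Algebra.TensorProduct.map ε (AlgHom.id k A)

@[simp]
theorem mapLeft_tmul (ε : A →ₐ[k] κ) (a b : A) : mapLeft ε (a ⊗ₜ b) = ε a ⊗ₜ b := by
  simp [mapLeft]

/-- The graph of the point is the pullback of the diagonal. Concretely, `c ⊗ a` differs from its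
value by the multiple `c ⊗ 1` of the image of `1 ⊗ a - a ⊗ 1`. -/
theorem pointIdeal_eq_map (ε : A →ₐ[k] κ) :
    pointIdeal ε = (KaehlerDifferential.ideal k A).map (mapLeft ε) := by
  apply le_antisymm
  · intro t ht
    have key : ∀ t : κ ⊗[k] A, t - evalPoint ε t ⊗ₜ[k] (1 : A) ∈
        (KaehlerDifferential.ideal k A).map (mapLeft ε) := by
      intro t
      induction t with
      | zero => simp
      | add x y hx hy =>
        have := add_mem hx hy
        rw [map_add, TensorProduct.add_tmul]
        convert this using 1
        ring
      | tmul c a =>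
        have h1 : (1 : A) ⊗ₜ[k] a - a ⊗ₜ[k] (1 : A) ∈ KaehlerDifferential.ideal k A :=
          KaehlerDifferential.one_smul_sub_smul_one_mem_ideal k a
        have h2 := Ideal.mul_mem_left _ (c ⊗ₜ[k] (1 : A)) (Ideal.mem_map_of_mem (mapLeft ε) h1)
        simpa [mul_sub] using h2
    have h := key t
    rw [show evalPoint ε t = 0 from ht] at h
    simpa using h
  · rw [Ideal.map_le_iff_le_comap]
    intro t ht
    have h : ((evalPoint ε).restrictScalars k).comp (mapLeft ε) =
        ε.comp (Algebra.TensorProduct.lmul' k) := by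
      ext <;> simp
    change evalPoint ε (mapLeft ε t) = 0
    have := congr($h t)
    simp only [AlgHom.comp_apply, AlgHom.restrictScalars_apply] at this
    rw [this, show Algebra.TensorProduct.lmul' k t = 0 from ht, map_zero]

end JetCriterion

/-- If `S = A + I` and `I` is finitely generated, then `S / I ^ n` is finite over `A`. -/
theorem finite_quotient_pow {A S : Type*} [CommRing A] [CommRing S] [Algebra A S] {I : Ideal S}
    (hI : I.FG) (hsurj : ∀ s : S, ∃ a : A, s - algebraMap A S a ∈ I) (n : ℕ) :
    Module.Finite A (S ⧸ I ^ n) := by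
  suffices h : ∃ N : Submodule A S, N.FG ∧ N ⊔ (I ^ n).restrictScalars A = ⊤ by
    obtain ⟨N, hN, htop⟩ := h
    have := Module.Finite.iff_fg.mpr hN
    refine Module.Finite.of_surjective
      ((Ideal.Quotient.mkₐ A (I ^ n)).toLinearMap ∘ₗ N.subtype) fun x => ?_
    obtain ⟨s, rfl⟩ := Ideal.Quotient.mk_surjective x
    obtain ⟨y, hy, z, hz, rfl⟩ := Submodule.mem_sup.mp (htop ▸ Submodule.mem_top : s ∈ _)
    refine ⟨⟨y, hy⟩, ?_⟩
    change Ideal.Quotient.mk _ y = Ideal.Quotient.mk _ (y + z)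
    rw [map_add, Ideal.Quotient.eq_zero_iff_mem.mpr hz, add_zero]
  induction n with
  | zero => exact ⟨⊥, Submodule.fg_bot, by simp [Ideal.one_eq_top]⟩
  | succ n ih =>
    obtain ⟨N, hN, htop⟩ := ih
    obtain ⟨G, hG⟩ := hI.pow (n := n)
    refine ⟨N ⊔ Submodule.span A G, hN.sup ⟨G, rfl⟩, ?_⟩
    -- Modulo `I ^ (n + 1)` the coefficients of the generators of `I ^ n` matter only modulo `I`, so
    -- they may be taken in `A`.
    have hle : (I ^ n).restrictScalars A ≤
        Submodule.span A (G : Set S) ⊔ (I ^ (n + 1)).restrictScalars A := by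
      intro x hx
      rw [Submodule.restrictScalars_mem, ← hG] at hx
      induction hx using Submodule.span_induction with
      | mem x h => exact Submodule.mem_sup_left (Submodule.subset_span h)
      | zero => exact zero_mem _
      | add x y _ _ h1 h2 => exact add_mem h1 h2
      | smul s x hx h =>
        obtain ⟨a, ha⟩ := hsurj s
        have : s • x = a • x + (s - algebraMap A S a) * x := by
          rw [Algebra.smul_def a, smul_eq_mul]; ring
        rw [this]
        refine add_mem (Submodule.smul_mem _ _ h) (Submodule.mem_sup_right ?_)
        change _ ∈ I ^ (n + 1)
        rw [pow_succ']
        exact Ideal.mul_mem_mul ha (hG ▸ hx)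
    rw [eq_top_iff, ← htop, sup_assoc]
    exact sup_le le_sup_left (hle.trans le_sup_right)

end TaylorMap

/-! ### Spreading out injectivity of jets under specialization -/

namespace TaylorMap

/-- Linear maps from a finite module to the fraction field of `A / p` lift to `A / p` after
multiplication by an element outside `p`. -/
theorem exists_smul_eq_of_finite {A κ T β : Type*} [CommRing A] [IsNoetherianRing A] [Field κ]
    [Algebra A κ] [AddCommGroup T] [Module A T] [Module.Finite A T] [Finite β]
    (hκ : ∀ c : κ, ∃ a s : A, algebraMap A κ s ≠ 0 ∧ c * algebraMap A κ s = algebraMap A κ a)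
    (h : β → T →ₗ[A] κ) :
    ∃ s : A, algebraMap A κ s ≠ 0 ∧ ∃ h' : β → T →ₗ[A] A ⧸ RingHom.ker (algebraMap A κ),
      ∀ i t, RingHom.kerLift (algebraMap A κ) (h' i t) = algebraMap A κ s * h i t := by
  set p := RingHom.ker (algebraMap A κ)
  have : p.IsPrime := RingHom.ker_isPrime _
  let g : (A ⧸ p) →ₗ[A] κ :=
    { toFun := RingHom.kerLift (algebraMap A κ)
      map_add' := map_add _
      map_smul' := fun a x => by
        obtain ⟨y, rfl⟩ := Ideal.Quotient.mk_surjective x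
        simp [Algebra.smul_def, p] }
  have hg : Function.Injective g := RingHom.kerLift_injective (algebraMap A κ)
  have hloc : IsLocalizedModule p.primeCompl g :=
    { map_units := fun x => by
        have hx : algebraMap A κ x ≠ 0 := fun hx => x.2 hx
        rw [Module.End.isUnit_iff]
        refine ⟨fun y z hyz => ?_, fun y => ⟨(algebraMap A κ x)⁻¹ * y, ?_⟩⟩
        · simpa [Algebra.smul_def, hx] using hyz
        · simp [Algebra.smul_def, hx]
      surj := fun c => by
        obtain ⟨a, s, hs, e⟩ := hκ c
        refine ⟨⟨Ideal.Quotient.mk _ a, ⟨s, hs⟩⟩, ?_⟩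
        change s • c = RingHom.kerLift (algebraMap A κ) (Ideal.Quotient.mk _ a)
        rw [Algebra.smul_def, mul_comm, e]; rfl
      exists_of_eq := fun e => ⟨1, by rw [hg e]⟩ }
  have := Module.finitePresentation_of_finite A T
  -- All functionals are treated as a single map to a finite power of `κ`, so that one denominator
  -- serves them all.
  let G : (β → A ⧸ p) →ₗ[A] (β → κ) := LinearMap.pi fun i => g ∘ₗ LinearMap.proj i
  have hloc' : IsLocalizedModule p.primeCompl G := IsLocalizedModule.pi p.primeCompl fun _ => g
  obtain ⟨h', s, e⟩ := Module.FinitePresentation.exists_lift_of_isLocalizedModule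
    p.primeCompl G (LinearMap.pi h)
  refine ⟨s, fun hs => s.2 hs, fun i => LinearMap.proj i ∘ₗ h', fun i t => ?_⟩
  have := congr($e t i)
  rw [← Algebra.smul_def]
  exact this

section Spread

variable {k A κ V ι : Type*} [Field k] [CommRing A] [Algebra k A] [Field κ] [Algebra k κ]
  [AddCommGroup V] [Module k V]

/-- A functional on `A ⊗ₖ A` that is semilinear along `δ : A → L` and kills `I ^ (n + 1)`
extends to `L ⊗ₖ A` modulo the `(n + 1)`st power of the ideal of the point `δ`. -/
theorem exists_extension (δ : A →ₐ[k] κ) (n : ℕ) (w : A ⊗[k] A →ₗ[k] κ)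
    (hw : ∀ a z, w ((a ⊗ₜ 1) * z) = δ a * w z)
    (hI : ∀ z ∈ KaehlerDifferential.ideal k A ^ (n + 1), w z = 0) :
    ∃ W : κ ⊗[k] A →ₗ[κ] κ, (∀ a, W (1 ⊗ₜ a) = w (1 ⊗ₜ a)) ∧
      ∀ z ∈ pointIdeal δ ^ (n + 1), W z = 0 := by
  let W : κ ⊗[k] A →ₗ[κ] κ :=
    (w ∘ₗ TensorProduct.mk k A A 1).liftBaseChange κ
  have hW : ∀ c a, W (c ⊗ₜ a) = c * w (1 ⊗ₜ a) := fun c a => by simp [W]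
  have hW' : ∀ c : κ, ∀ z, W ((c ⊗ₜ 1) * mapLeft δ z) = c * w z := by
    intro c z
    induction z with
    | zero => simp
    | add x y hx hy => simp only [map_add, mul_add, hx, hy]
    | tmul a b =>
      have := hw a (1 ⊗ₜ b)
      rw [Algebra.TensorProduct.tmul_mul_tmul, mul_one, one_mul] at this
      rw [mapLeft_tmul, Algebra.TensorProduct.tmul_mul_tmul, one_mul, hW, this, mul_assoc]
  refine ⟨W, fun a => by rw [hW, one_mul], fun z hz => ?_⟩
  rw [pointIdeal_eq_map, ← Ideal.map_pow] at hz
  induction hz using Submodule.span_induction with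
  | mem x h =>
    obtain ⟨y, hy, rfl⟩ := h
    have := hW' 1 y
    rw [← Algebra.TensorProduct.one_def, one_mul, one_mul] at this
    exact this.trans (hI y hy)
  | zero => exact map_zero _
  | add x y _ _ hx hy => rw [map_add, hx, hy, add_zero]
  -- Vanishing of `W` at `x` alone says nothing about `y * x`, so a second induction treats all
  -- multiples at once: a factor from `κ` comes out by linearity, and a factor from `A` is absorbed
  -- by `I ^ (n + 1)`.
  | smul y x hx _ =>
    clear * - hW' hI hx
    rw [smul_eq_mul]
    induction hx using Submodule.span_induction generalizing y with
    | mem x h =>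
      obtain ⟨z, hz, rfl⟩ := h
      induction y with
      | zero => simp
      | add a b ha hb => rw [add_mul, map_add, ha, hb, add_zero]
      | tmul c a =>
        have := hW' c ((1 ⊗ₜ a) * z)
        rw [hI _ (Ideal.mul_mem_left _ _ hz), map_mul (mapLeft δ), mapLeft_tmul, ← mul_assoc,
          Algebra.TensorProduct.tmul_mul_tmul, map_one, mul_one, one_mul, mul_zero] at this
        exact this
    | zero => simp
    | add a b _ _ ha hb => rw [mul_add, map_add, ha, hb, add_zero]
    | smul a b _ hb => rw [smul_eq_mul, ← mul_assoc]; exact hb _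

/-- A left inverse of the jet map over `κ` is given by functionals on a finite power of the finite
`A`-module `Q`. By `hκ` the field `κ` is the fraction field of `A / ker ε`, so a common denominator
`s` makes them `A / ker ε`-valued, and `δ` carries them to `L`. There they invert the jet map up to
the factor `δ s`. No flatness of `Q` is involved. -/
theorem JetInjective.exists_spread [Algebra.FiniteType k A] [FiniteDimensional k V]
    [Finite ι] (ε : A →ₐ[k] κ) (hκ : ∀ c : κ, ∃ a s : A, ε s ≠ 0 ∧ c * ε s = ε a)
    (φ : ι → V →ₗ[k] A) (n : ℕ) (h : JetInjective ε φ n) :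
    ∃ s : A, ε s ≠ 0 ∧ ∀ (L : Type u) (_ : Field L) (_ : Algebra k L) (δ : A →ₐ[k] L),
      RingHom.ker ε ≤ RingHom.ker δ → δ s ≠ 0 → JetInjective δ φ n := by
  classical
  have := Fintype.ofFinite ι
  have : IsNoetherianRing A := Algebra.FiniteType.isNoetherianRing k A
  have : IsNoetherianRing (A ⊗[k] A) := Algebra.FiniteType.isNoetherianRing A _
  let I := KaehlerDifferential.ideal k A
  let D := pointIdeal ε
  let Q := (A ⊗[k] A) ⧸ I ^ (n + 1)
  have hQ : Module.Finite A Q := by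
    -- Modulo `I` every tensor is congruent to `a ⊗ 1`, with `a` its image under multiplication.
    refine finite_quotient_pow (IsNoetherian.noetherian I) (fun s =>
      ⟨Algebra.TensorProduct.lmul' k s, ?_⟩) (n + 1)
    simp [I, KaehlerDifferential.ideal, RingHom.mem_ker]
  let b := Module.finBasis k V
  let J : κ ⊗[k] V →ₗ[κ] ι → (κ ⊗[k] A) ⧸ D ^ (n + 1) :=
    LinearMap.pi fun j => (Ideal.Quotient.mkₐ κ (D ^ (n + 1))).toLinearMap ∘ₗ (φ j).baseChange κ
  have hJ : Function.Injective J := by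
    rw [injective_iff_map_eq_zero]
    exact fun t ht => h t fun j => Ideal.Quotient.eq_zero_iff_mem.mp (congrFun ht j)
  obtain ⟨ρ, hρ⟩ := J.exists_leftInverse_of_injective (LinearMap.ker_eq_bot.mpr hJ)
  have hle : I ^ (n + 1) ≤ (D ^ (n + 1)).comap (mapLeft ε) := by
    rw [← Ideal.map_le_iff_le_comap, Ideal.map_pow]
    exact Ideal.pow_right_mono (pointIdeal_eq_map ε).ge _
  let u : Q →ₐ[k] (κ ⊗[k] A) ⧸ D ^ (n + 1) := Ideal.quotientMapₐ _ (mapLeft ε) hle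
  let _ : Algebra A κ := ε.toRingHom.toAlgebra
  have hu : ∀ (a : A) (q : Q), u (a • q) = ε a • u q := by
    intro a q
    obtain ⟨z, rfl⟩ := Ideal.Quotient.mk_surjective q
    change Ideal.Quotient.mk _ (mapLeft ε (a • z)) = Ideal.Quotient.mk _ (ε a • mapLeft ε z)
    rw [Algebra.smul_def a, map_mul, Algebra.TensorProduct.algebraMap_apply, mapLeft_tmul,
      Algebra.smul_def, Algebra.TensorProduct.algebraMap_apply]
    rfl
  let H : Fin (Module.finrank k V) → (ι → Q) →ₗ[A] κ := fun i =>
    { toFun := fun t => (b.baseChange κ).coord i (ρ fun j => u (t j))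
      map_add' := fun t t' => by
        rw [← map_add, ← map_add]; congr 2; ext j; exact map_add u _ _
      map_smul' := fun a t => by
        have e : (fun j => u ((a • t) j)) = ε a • fun j => u (t j) := funext fun j => hu a _
        rw [e, map_smul, map_smul]
        rfl }
  obtain ⟨s, hs, H', hH'⟩ := exists_smul_eq_of_finite (A := A) (κ := κ) hκ H
  refine ⟨s, hs, fun L _ _ δ hδ hδs t ht => ?_⟩
  let δ' : A ⧸ RingHom.ker (algebraMap A κ) →+* L := Ideal.Quotient.lift _ δ.toRingHom hδ
  have hδ' : ∀ (a : A) x, δ' (a • x) = δ a * δ' x := by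
    intro a x
    rw [Algebra.smul_def, map_mul]
    rfl
  have hmk : ∀ (i) (j) (a : A) (z : A ⊗[k] A),
      δ' (H' i (Pi.single j (Ideal.Quotient.mk _ ((a ⊗ₜ 1) * z)))) =
        δ a * δ' (H' i (Pi.single j (Ideal.Quotient.mk _ z))) := by
    intro i j a z
    rw [← hδ', ← map_smul, ← Pi.single_smul]
    congr 3
    change _ = Ideal.Quotient.mk _ (a • z)
    rw [Algebra.smul_def a z]
    rfl
  let w : Fin (Module.finrank k V) → ι → A ⊗[k] A →ₗ[k] L := fun i j =>
    { toFun := fun z => δ' (H' i (Pi.single j (Ideal.Quotient.mk _ z)))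
      map_add' := fun z z' => by
        rw [← map_add δ', ← map_add (H' i), ← Pi.single_add, ← map_add]
      map_smul' := fun c z => by
        rw [RingHom.id_apply, Algebra.smul_def c (δ' _), ← δ.commutes, ← hmk, Algebra.smul_def c z]
        rfl }
  have hw : ∀ i j a z, w i j ((a ⊗ₜ 1) * z) = δ a * w i j z := hmk
  have hwI : ∀ i j, ∀ z ∈ I ^ (n + 1), w i j z = 0 := by
    intro i j z hz
    change δ' (H' i (Pi.single j (Ideal.Quotient.mk _ z))) = 0
    rw [Ideal.Quotient.eq_zero_iff_mem.mpr hz, Pi.single_zero, map_zero, map_zero]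
  choose W hW hWD using fun i j => exists_extension δ n (w i j) (hw i j) (hwI i j)
  have key : ∀ i v, ∑ j, w i j (1 ⊗ₜ φ j v) = δ s * algebraMap k L (b.repr v i) := by
    intro i v
    let t : ι → Q := fun j => Ideal.Quotient.mk _ (1 ⊗ₜ φ j v)
    have hHt : H i t = algebraMap k κ (b.repr v i) := by
      have e : (fun j => u (t j)) = J (1 ⊗ₜ v) := by
        ext j
        change Ideal.Quotient.mk _ (mapLeft ε (1 ⊗ₜ φ j v)) = Ideal.Quotient.mk _ _
        simp
      change (b.baseChange κ).coord i (ρ fun j => u (t j)) = _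
      rw [e, show ρ (J (1 ⊗ₜ v)) = 1 ⊗ₜ v from congr($hρ (1 ⊗ₜ v))]
      simp [Algebra.smul_def]
    -- The identity may be checked in `κ`, into which `A / ker ε` embeds.
    have hH't : H' i t = Ideal.Quotient.mk _ (s * algebraMap k A (b.repr v i)) := by
      apply RingHom.kerLift_injective (algebraMap A κ)
      rw [hH', hHt, RingHom.kerLift_mk, map_mul]
      congr 1
      exact (ε.commutes _).symm
    calc ∑ j, w i j (1 ⊗ₜ φ j v) = δ' (H' i (∑ j, Pi.single j (t j))) := by
          rw [map_sum, map_sum]; rfl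
      _ = _ := by
          rw [Finset.univ_sum_single, hH't]
          change δ _ = _
          rw [map_mul, δ.commutes]
  have key' : ∀ i, ∑ j, W i j ∘ₗ (φ j).baseChange L = δ s • (b.baseChange L).coord i := by
    intro i
    ext v
    simp [hW, key, Algebra.smul_def]
  apply (b.baseChange L).ext_elem
  intro i
  have := congr($(key' i) t)
  simp only [LinearMap.sum_apply, LinearMap.comp_apply, hWD _ _ _ (ht _), Finset.sum_const_zero,
    LinearMap.smul_apply, smul_eq_mul] at this
  simpa [hδs] using this.symm

end Spread

end TaylorMap

/-! ### Jet rings and localization -/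

namespace TaylorMap

section JetRing

variable {k A κ : Type*} [Field k] [CommRing A] [Algebra k A] [Field κ] [Algebra k κ]

/-- The ring of `n`-jets at a `κ`-valued point of `A`. -/
abbrev JetRing (ε : A →ₐ[k] κ) (n : ℕ) : Type _ := (κ ⊗[k] A) ⧸ pointIdeal ε ^ (n + 1)

/-- The value of a jet. -/
def jetEval (ε : A →ₐ[k] κ) (n : ℕ) : JetRing ε n →ₐ[κ] κ :=
  Ideal.Quotient.liftₐ _ (evalPoint ε) fun _ h => Ideal.pow_le_self n.succ_ne_zero h

@[simp]
theorem jetEval_mk (ε : A →ₐ[k] κ) (n : ℕ) (z : κ ⊗[k] A) :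
    jetEval ε n (Ideal.Quotient.mk _ z) = evalPoint ε z := rfl

theorem ker_jetEval_pow (ε : A →ₐ[k] κ) (n : ℕ) : RingHom.ker (jetEval ε n) ^ (n + 1) = ⊥ := by
  have : RingHom.ker (jetEval ε n) =
      (pointIdeal ε).map (Ideal.Quotient.mk (pointIdeal ε ^ (n + 1))) := by
    ext z
    obtain ⟨z, rfl⟩ := Ideal.Quotient.mk_surjective z
    constructor
    · exact fun h => Ideal.mem_map_of_mem _ (show z ∈ pointIdeal ε from h)
    · intro h
      refine (Ideal.map_le_iff_le_comap (I := pointIdeal ε)).mpr ?_ h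
      exact fun _ h => h
  rw [this, ← Ideal.map_pow, Ideal.map_quotient_self]

/-- Divided by its nonzero value, such a jet is `1` plus a nilpotent. -/
instance isLocalHom_jetEval (ε : A →ₐ[k] κ) (n : ℕ) : IsLocalHom (jetEval ε n).toRingHom where
  map_nonunit z hz := by
    have hz : jetEval ε n z ≠ 0 := hz.ne_zero
    have h1 : z * algebraMap κ _ (jetEval ε n z)⁻¹ - 1 ∈ RingHom.ker (jetEval ε n) := by
      rw [RingHom.mem_ker, map_sub, map_mul, AlgHom.commutes, map_one, Algebra.algebraMap_self,
        RingHom.id_apply, mul_inv_cancel₀ hz, sub_self]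
    have h2 : IsNilpotent (z * algebraMap κ _ (jetEval ε n z)⁻¹ - 1) :=
      ⟨n + 1, by simpa [ker_jetEval_pow] using Ideal.pow_mem_pow h1 (n + 1)⟩
    have h3 := h2.isUnit_add_one
    rw [sub_add_cancel] at h3
    exact isUnit_of_mul_isUnit_left h3

instance isLocalRing_jetRing (ε : A →ₐ[k] κ) (n : ℕ) : IsLocalRing (JetRing ε n) :=
  RingHom.domain_isLocalRing (jetEval ε n).toRingHom

/-- The Taylor expansion of a function at a `κ`-valued point. -/
def toJetRing (ε : A →ₐ[k] κ) (n : ℕ) : A →ₐ[k] JetRing ε n :=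
  (Ideal.Quotient.mkₐ k _).comp Algebra.TensorProduct.includeRight

theorem toJetRing_apply (ε : A →ₐ[k] κ) (n : ℕ) (a : A) :
    toJetRing ε n a = Ideal.Quotient.mk _ (1 ⊗ₜ a) := rfl

theorem jetEval_toJetRing (ε : A →ₐ[k] κ) (n : ℕ) (a : A) :
    jetEval ε n (toJetRing ε n a) = ε a := by
  simp [toJetRing_apply]

/-- The criterion for jets is insensitive to localization. -/
theorem JetInjective.of_isLocalization {V ι O : Type*} [AddCommGroup V] [Module k V]
    [CommRing O] [Algebra k O]
    [Algebra A O] [IsScalarTower k A O] (S : Submonoid A) [IsLocalization S O] (ε : O →ₐ[k] κ)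
    (φ : ι → V →ₗ[k] A) (n : ℕ)
    (h : JetInjective (ε.comp (Algebra.algHom k A O)) φ n) :
    JetInjective ε (fun j => (Algebra.algHom k A O).toLinearMap ∘ₗ φ j) n := by
  let ε' := ε.comp (Algebra.algHom k A O)
  -- The jet ring is local, so an element of `S`, whose value is nonzero, has invertible Taylor
  -- expansion; hence the expansion extends to `O`.
  have hunit : ∀ s : S, IsUnit (toJetRing ε' n s) := fun s => by
    apply isUnit_of_map_unit (jetEval ε' n).toRingHom
    change IsUnit (jetEval ε' n (toJetRing ε' n s))
    rw [jetEval_toJetRing]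
    exact (IsLocalization.map_units O s).map ε
  let ψ₀ : O →ₐ[k] JetRing ε' n := IsLocalization.liftAlgHom (M := S) (f := toJetRing ε' n) hunit
  have hψ₀ : ∀ a, ψ₀ (algebraMap A O a) = toJetRing ε' n a :=
    fun a => IsLocalization.lift_eq hunit a
  let ψ : κ ⊗[k] O →ₐ[κ] JetRing ε' n :=
    Algebra.TensorProduct.lift (Algebra.ofId κ _) ψ₀ fun _ _ => Commute.all _ _
  have hψ : ∀ z : κ ⊗[k] A, ψ (Algebra.TensorProduct.map (AlgHom.id κ κ)
      (Algebra.algHom k A O) z) = Ideal.Quotient.mk _ z := by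
    intro z
    induction z with
    | zero => simp
    | add x y hx hy => simp only [map_add, hx, hy]
    | tmul c a =>
      change ψ (c ⊗ₜ algebraMap A O a) = _
      rw [Algebra.TensorProduct.lift_tmul, hψ₀, toJetRing_apply]
      change Ideal.Quotient.mk _ ((c ⊗ₜ 1) * (1 ⊗ₜ a)) = _
      rw [Algebra.TensorProduct.tmul_mul_tmul, mul_one, one_mul]
  have hev : ∀ z, jetEval ε' n (ψ z) = evalPoint ε z := by
    have h1 : ((jetEval ε' n).restrictScalars k).comp ψ₀ = ε := by
      apply IsLocalization.algHom_ext S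
      ext a
      change jetEval ε' n (ψ₀ (algebraMap A O a)) = _
      rw [hψ₀, jetEval_toJetRing]
    have h2 : (jetEval ε' n).comp ψ = evalPoint ε := by
      ext a
      simpa [ψ] using congr($h1 a)
    exact fun z => congr($h2 z)
  intro t ht
  refine h t fun j => ?_
  rw [← Ideal.Quotient.eq_zero_iff_mem, ← hψ]
  have hle : (pointIdeal ε).map ψ ≤ RingHom.ker (jetEval ε' n) := by
    rw [Ideal.map_le_iff_le_comap]
    intro z hz
    exact (hev z).trans hz
  have hmem := Ideal.mem_map_of_mem ψ (ht j)
  rw [Ideal.map_pow] at hmem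
  have := Ideal.pow_right_mono hle (n + 1) hmem
  rw [ker_jetEval_pow, Ideal.mem_bot] at this
  rw [← this]
  congr 1
  clear * -
  induction t with
  | zero => simp
  | add x y hx hy => simp only [map_add, hx, hy]
  | tmul c v => rfl

/-- Any homomorphism `l` carries the ideal of the point `ε ∘ l` into that of `ε`, so this direction
needs no localization hypothesis. -/
theorem JetInjective.to_isLocalization {V ι O : Type*} [AddCommGroup V] [Module k V]
    [CommRing O] [Algebra k O] (l : A →ₐ[k] O) (ε : O →ₐ[k] κ)
    (φ : ι → V →ₗ[k] A) (n : ℕ)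
    (h : JetInjective ε (fun j => l.toLinearMap ∘ₗ φ j) n) :
    JetInjective (ε.comp l) φ n := by
  intro t ht
  refine h t fun j => ?_
  have hle : (pointIdeal (ε.comp l)).map (Algebra.TensorProduct.map (AlgHom.id κ κ) l) ≤
      pointIdeal ε := by
    rw [Ideal.map_le_iff_le_comap]
    intro z hz
    have h2 : (evalPoint ε).comp (Algebra.TensorProduct.map (AlgHom.id κ κ) l) =
        evalPoint (ε.comp l) := by
      ext a
      simp
    exact congr($h2 z).trans hz
  have hmem := Ideal.mem_map_of_mem (Algebra.TensorProduct.map (AlgHom.id κ κ) l) (ht j)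
  rw [Ideal.map_pow] at hmem
  convert Ideal.pow_right_mono hle (n + 1) hmem
  clear * -
  induction t with
  | zero => simp
  | add x y hx hy => simp only [map_add, hx, hy]
  | tmul c v => rfl

end JetRing

/-! ### Krull intersection over an algebraically closed field -/

section AlgClosed

variable {k : Type*} [Field k]

/-- Quantifying over all subalgebras that contain `s` lets two tensors be descended to a common
finitely generated one. -/
theorem exists_finset_mem_range_map {K B : Type*} [CommRing K] [Algebra k K] [CommRing B]
    [Algebra k B] (x : K ⊗[k] B) :
    ∃ s : Finset K, ∀ C : Subalgebra k K, (s : Set K) ⊆ C →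
      ∃ y : C ⊗[k] B, Algebra.TensorProduct.map C.val (AlgHom.id k B) y = x := by
  classical
  induction x with
  | zero => exact ⟨∅, fun C _ => ⟨0, map_zero _⟩⟩
  | add x y hx hy =>
    obtain ⟨s, hs⟩ := hx
    obtain ⟨t, ht⟩ := hy
    refine ⟨s ∪ t, fun C hC => ?_⟩
    rw [Finset.coe_union, Set.union_subset_iff] at hC
    obtain ⟨x', hx'⟩ := hs C hC.1
    obtain ⟨y', hy'⟩ := ht C hC.2
    exact ⟨x' + y', by rw [map_add, hx', hy']⟩
  | tmul c b =>
    refine ⟨{c}, fun C hC => ⟨⟨c, by simpa using hC⟩ ⊗ₜ b, by simp⟩⟩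

/-- A nonzero element of a finitely generated domain over an algebraically closed field is
nonzero at some rational point. -/
theorem exists_algHom_apply_ne_zero [IsAlgClosed k] {C : Type*} [CommRing C] [IsDomain C]
    [Algebra k C] [Algebra.FiniteType k C] {c : C} (hc : c ≠ 0) : ∃ χ : C →ₐ[k] k, χ c ≠ 0 := by
  have hJ : IsJacobsonRing C := isJacobsonRing_of_finiteType (A := k)
  have h1 : (⊥ : Ideal C).jacobson = ⊥ := hJ.out Ideal.isPrime_bot.isRadical
  have h2 : c ∉ (⊥ : Ideal C).jacobson := by rw [h1]; exact hc
  rw [Ideal.jacobson, Submodule.mem_sInf] at h2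
  push Not at h2
  obtain ⟨m, ⟨-, hm⟩, hcm⟩ := h2
  let _ : Field (C ⧸ m) := Ideal.Quotient.field m
  have : Module.Finite k (C ⧸ m) := finite_of_finite_type_of_isJacobsonRing k (C ⧸ m)
  have hb := IsAlgClosed.algebraMap_bijective_of_isIntegral (k := k) (K := C ⧸ m)
  let e : k ≃ₐ[k] C ⧸ m := AlgEquiv.ofBijective (Algebra.ofId k _) hb
  refine ⟨(e.symm : C ⧸ m →ₐ[k] k).comp (Ideal.Quotient.mkₐ k m), ?_⟩
  simpa [Ideal.Quotient.eq_zero_iff_mem] using hcm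

/-- A field extension of an algebraically closed field tensored with a domain has no zero
divisors. -/
theorem eq_zero_or_eq_zero_of_mul_eq_zero [IsAlgClosed k] {K B : Type*} [Field K] [Algebra k K]
    [CommRing B] [IsDomain B] [Algebra k B] {x y : K ⊗[k] B} (hxy : x * y = 0) :
    x = 0 ∨ y = 0 := by
  classical
  obtain ⟨s, hs⟩ := exists_finset_mem_range_map x
  obtain ⟨t, ht⟩ := exists_finset_mem_range_map y
  let C := Algebra.adjoin k ((s ∪ t : Finset K) : Set K)
  have hC : ((s ∪ t : Finset K) : Set K) ⊆ C := Algebra.subset_adjoin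
  have : Algebra.FiniteType k C := C.fg_iff_finiteType.mp ⟨s ∪ t, rfl⟩
  rw [Finset.coe_union, Set.union_subset_iff] at hC
  obtain ⟨x, rfl⟩ := hs C hC.1
  obtain ⟨y, rfl⟩ := ht C hC.2
  have hinj : Function.Injective (Algebra.TensorProduct.map C.val (AlgHom.id k B)) :=
    Module.Flat.rTensor_preserves_injective_linearMap (M := B) C.val.toLinearMap
      Subtype.val_injective
  rw [← map_mul, map_eq_zero_iff _ hinj] at hxy
  let b := Module.Basis.ofVectorSpace k B
  let e := TensorProduct.equivFinsuppOfBasisRight (M := C) b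
  by_contra! hne
  have hx : e x ≠ 0 := by
    rw [Ne, map_eq_zero_iff e e.injective]; rintro rfl; exact hne.1 (map_zero _)
  have hy : e y ≠ 0 := by
    rw [Ne, map_eq_zero_iff e e.injective]; rintro rfl; exact hne.2 (map_zero _)
  obtain ⟨i, hi⟩ := Finsupp.ne_iff.mp hx
  obtain ⟨j, hj⟩ := Finsupp.ne_iff.mp hy
  -- A rational point at which one coefficient of `x` and one of `y` are both nonzero specializes
  -- `x` and `y` to nonzero elements of the domain `B` with product zero.
  obtain ⟨χ, hχ⟩ := exists_algHom_apply_ne_zero (k := k) (mul_ne_zero hi hj)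
  rw [map_mul, mul_ne_zero_iff] at hχ
  let T : C ⊗[k] B →ₐ[k] B :=
    Algebra.TensorProduct.lift ((Algebra.ofId k B).comp χ) (AlgHom.id k B)
      fun _ _ => Commute.all _ _
  have hT : ∀ z i, b.repr (T z) i = χ (e z i) := by
    intro z i
    induction z with
    | zero => simp
    | add x y hx hy => simp only [map_add, Finsupp.add_apply, hx, hy]
    | tmul c v =>
      rw [Algebra.TensorProduct.lift_tmul]
      change b.repr (algebraMap k B (χ c) * v) i = _
      rw [← Algebra.smul_def, map_smul]
      simp [e, mul_comm]
  have h := congr(T $hxy)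
  rw [map_mul, map_zero, mul_eq_zero] at h
  rcases h with h | h
  · exact hχ.1 (by rw [← hT, h]; simp)
  · exact hχ.2 (by rw [← hT, h]; simp)

theorem equivFinsuppOfBasisLeft_lTensor {κ M N β : Type*} [DecidableEq β] [AddCommGroup κ]
    [Module k κ] [AddCommGroup M] [Module k M] [AddCommGroup N] [Module k N] (b : Module.Basis β k κ)
    (g : M →ₗ[k] N) (z : κ ⊗[k] M) (i : β) :
    TensorProduct.equivFinsuppOfBasisLeft b (g.lTensor κ z) i =
      g (TensorProduct.equivFinsuppOfBasisLeft b z i) := by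
  induction z with
  | zero => simp
  | add x y hx hy => simp only [map_add, Finsupp.add_apply, hx, hy]
  | tmul c v => simp

variable {O κ V ι : Type*} [CommRing O] [Algebra k O] [Field κ] [Algebra k κ]
  [AddCommGroup V] [Module k V]

/-- If all primes of the reduced ring `O` are contained in the kernel of `ε`, then an element of
`κ ⊗ₖ O` that does not vanish at `ε` is not a zero divisor. -/
theorem eq_zero_of_mul_eq_zero [IsAlgClosed k] [IsReduced O] (ε : O →ₐ[k] κ)
    (hε : ∀ P : Ideal O, P.IsPrime → P ≤ RingHom.ker ε) {d z : κ ⊗[k] O}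
    (hd : evalPoint ε d ≠ 0) (hdz : d * z = 0) : z = 0 := by
  classical
  let c := Module.Basis.ofVectorSpace k κ
  apply (TensorProduct.equivFinsuppOfBasisLeft c).injective
  rw [map_zero]
  ext i
  -- The coordinates of `z` along a basis of `κ` lie in the reduced ring `O`, so it suffices that
  -- they lie in every prime `P`.
  rw [Finsupp.zero_apply, ← isNilpotent_iff_eq_zero, ← mem_nilradical, nilradical_eq_sInf,
    Submodule.mem_sInf]
  intro (P : Ideal O) (hP : P.IsPrime)
  let q := Algebra.TensorProduct.map (AlgHom.id κ κ) (Ideal.Quotient.mkₐ k P)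
  let εP : O ⧸ P →ₐ[k] κ := Ideal.Quotient.liftₐ P ε fun a ha => hε P hP ha
  have hq : ∀ z, evalPoint εP (q z) = evalPoint ε z := by
    have : (evalPoint εP).comp q = evalPoint ε := by
      ext a
      simp only [q, AlgHom.comp_apply, AlgHom.restrictScalars_apply,
        Algebra.TensorProduct.includeRight_apply, Algebra.TensorProduct.map_tmul, evalPoint_tmul]
      rfl
    exact fun z => congr($this z)
  have h : q d * q z = 0 := by rw [← map_mul, hdz, map_zero]
  rcases eq_zero_or_eq_zero_of_mul_eq_zero h with h | h
  · exact absurd (by rw [← hq, h, map_zero]) hd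
  · have h' : (Ideal.Quotient.mkₐ k P).toLinearMap.lTensor κ z = 0 := h
    have := equivFinsuppOfBasisLeft_lTensor c (Ideal.Quotient.mkₐ k P).toLinearMap z i
    rw [h', map_zero] at this
    exact Ideal.Quotient.eq_zero_iff_mem.mp this.symm

/-- The kernels of the jet maps stabilize in a finite-dimensional space, and the Krull intersection
theorem in `κ ⊗ O`, noetherian since essentially of finite type over `κ`, shows that the stable
kernel is zero. -/
theorem exists_forall_jetInjective [IsAlgClosed k] [IsReduced O] [Algebra.EssFiniteType k O]
    [FiniteDimensional k V] (ε : O →ₐ[k] κ) (hε : ∀ P : Ideal O, P.IsPrime → P ≤ RingHom.ker ε)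
    (φ : ι → V →ₗ[k] O) (hφ : ∀ v, (∀ j, φ j v = 0) → v = 0) :
    ∃ N, ∀ n, N ≤ n → JetInjective ε φ n := by
  classical
  have : IsNoetherianRing (κ ⊗[k] O) := Algebra.EssFiniteType.isNoetherianRing κ _
  let F : ℕ →o (Submodule κ (κ ⊗[k] V))ᵒᵈ :=
    { toFun := fun n => OrderDual.toDual (⨅ j, ((pointIdeal ε ^ (n + 1)).restrictScalars κ).comap
        ((φ j).baseChange κ))
      monotone' := fun n m hnm => OrderDual.toDual_le_toDual.mpr <| iInf_mono fun j =>
        Submodule.comap_mono fun _ h => Ideal.pow_le_pow_right (by omega) h }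
  have hF : ∀ n t, t ∈ OrderDual.ofDual (F n) ↔
      ∀ j, (φ j).baseChange κ t ∈ pointIdeal ε ^ (n + 1) := by
    intro n t
    simp [F, Submodule.mem_iInf]
  obtain ⟨N, hN⟩ := IsArtinian.monotone_stabilizes F
  suffices h : JetInjective ε φ N from ⟨N, fun n hn => h.mono hn⟩
  intro t ht
  have hzero : ∀ j, (φ j).baseChange κ t = 0 := by
    intro j
    have hmem : (φ j).baseChange κ t ∈
        (⨅ i : ℕ, pointIdeal ε ^ i • ⊤ : Submodule (κ ⊗[k] O) (κ ⊗[k] O)) := by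
      rw [Submodule.mem_iInf]
      intro i
      rw [smul_eq_mul, Ideal.mul_top]
      -- The chain is constant from `N` on, so `t` lies in all its members.
      have h1 : t ∈ OrderDual.ofDual (F (max N i)) := by
        rw [← hN _ (le_max_left _ _)]
        exact (hF N t).mpr ht
      exact Ideal.pow_le_pow_right (by omega) ((hF _ t).mp h1 j)
    rw [Ideal.mem_iInf_smul_pow_eq_bot_iff] at hmem
    obtain ⟨r, hr⟩ := hmem
    refine eq_zero_of_mul_eq_zero ε hε (d := 1 - r) ?_ ?_
    · rw [map_sub, map_one, show evalPoint ε r = 0 from r.2, sub_zero]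
      exact one_ne_zero
    · rw [sub_mul, one_mul, ← smul_eq_mul, hr, sub_self]
  -- Vanishing in `κ ⊗ O` is read off along a basis of `κ`, which reduces it to elements of `V`.
  let c := Module.Basis.ofVectorSpace k κ
  apply (TensorProduct.equivFinsuppOfBasisLeft c).injective
  rw [map_zero]
  ext i
  refine hφ _ fun j => ?_
  rw [← equivFinsuppOfBasisLeft_lTensor, show (φ j).lTensor κ t = 0 from hzero j]
  simp

end AlgClosed

end TaylorMap

/-! ### Morphisms from spectra of local rings, and the local ring on the diagonal -/

namespace TaylorMap

/-- The closed point of the spectrum of a local ring. -/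
def closedPt (R : Type u) [CommRing R] [IsLocalRing R] : ↥(Spec (CommRingCat.of R)) :=
  IsLocalRing.closedPoint R

theorem specMap_closedPt {R R' : Type u} [CommRing R] [IsLocalRing R] [CommRing R']
    [IsLocalRing R'] (π : CommRingCat.of R ⟶ CommRingCat.of R') [IsLocalHom π.hom] :
    Spec.map π (closedPt R') = closedPt R :=
  IsLocalRing.comap_closedPoint π.hom

theorem specMap_fromSpecStalk_closedPt {R : Type u} [CommRing R] [IsLocalRing R] {Y : Scheme.{u}}
    (y : Y) (φ : Y.presheaf.stalk y ⟶ .of R) [IsLocalHom φ.hom] :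
    (Spec.map φ ≫ Y.fromSpecStalk y) (closedPt R) = y :=
  (congrArg (Y.fromSpecStalk y) (IsLocalRing.comap_closedPoint φ.hom)).trans
    Scheme.fromSpecStalk_closedPoint

section StalkTo

variable {R : Type u} [CommRing R] [IsLocalRing R] {Y Z : Scheme.{u}}

/-- The homomorphism from the local ring at the image of the closed point to `R`. -/
def closedPtTo (g : Spec (.of R) ⟶ Y) : Y.presheaf.stalk (g (closedPt R)) ⟶ .of R :=
  Scheme.stalkClosedPointTo g

/-- The homomorphism from the local ring at `y` to `R` defined by a morphism from the spectrum of
the local ring `R` that sends the closed point to `y`. -/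
def stalkTo (g : Spec (.of R) ⟶ Y) (y : Y) (h : g (closedPt R) = y) :
    Y.presheaf.stalk y ⟶ .of R :=
  Y.presheaf.stalkSpecializes (specializes_of_eq h) ≫ closedPtTo g

theorem stalkTo_rfl (g : Spec (.of R) ⟶ Y) : stalkTo g _ rfl = closedPtTo g := by
  rw [stalkTo, TopCat.Presheaf.stalkSpecializes_refl, Category.id_comp]

instance (g : Spec (.of R) ⟶ Y) (y : Y) (h : g (closedPt R) = y) :
    IsLocalHom (stalkTo g y h).hom := by
  subst h
  rw [stalkTo_rfl]
  exact Scheme.isLocalHom_stalkClosedPointTo g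

theorem specMap_stalkTo (g : Spec (.of R) ⟶ Y) (y : Y) (h : g (closedPt R) = y) :
    Spec.map (stalkTo g y h) ≫ Y.fromSpecStalk y = g := by
  subst h
  rw [stalkTo_rfl]
  exact Scheme.Spec_stalkClosedPointTo_fromSpecStalk g

theorem stalkMap_stalkTo (g : Spec (.of R) ⟶ Y) (y : Y) (h : g (closedPt R) = y)
    (p : Y ⟶ Z) (z : Z) (hz : p y = z) :
    Z.presheaf.stalkSpecializes (specializes_of_eq hz) ≫ p.stalkMap y ≫ stalkTo g y h =
      stalkTo (g ≫ p) z (by rw [Scheme.Hom.comp_apply, h, hz]) := by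
  subst h
  subst hz
  rw [TopCat.Presheaf.stalkSpecializes_refl, Category.id_comp, stalkTo_rfl]
  exact (Scheme.stalkClosedPointTo_comp g p).symm.trans (stalkTo_rfl (g ≫ p)).symm

theorem stalkTo_specMap (y : Y) (φ : Y.presheaf.stalk y ⟶ .of R) [IsLocalHom φ.hom] (h) :
    stalkTo (Spec.map φ ≫ Y.fromSpecStalk y) y h = φ := by
  refine TopCat.Presheaf.stalk_hom_ext _ fun U hU => ?_
  rw [stalkTo, TopCat.Presheaf.germ_stalkSpecializes_assoc]
  exact Scheme.germ_stalkClosedPointTo_Spec_fromSpecStalk φ U _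

theorem stalkTo_comp {R' : Type u} [CommRing R'] [IsLocalRing R'] (g : Spec (.of R) ⟶ Y) (y : Y)
    (h : g (closedPt R) = y) (π : CommRingCat.of R ⟶ CommRingCat.of R')
    [IsLocalHom π.hom] (h') :
    stalkTo g y h ≫ π = stalkTo (Spec.map π ≫ g) y h' := by
  have e : Spec.map π ≫ g = Spec.map (stalkTo g y h ≫ π) ≫ Y.fromSpecStalk y := by
    rw [Spec.map_comp, Category.assoc, specMap_stalkTo]
  have : IsLocalHom (stalkTo g y h ≫ π).hom := by
    rw [CommRingCat.hom_comp]; infer_instance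
  simp only [e, stalkTo_specMap]

end StalkTo

variable {k : Type u} [Field k] {X : Scheme.{u}} (f : X ⟶ Spec (CommRingCat.of k))

/-- The reduction `𝒪_x → k_x`. -/
def residueHom (x : X) : StalkRing f x →ₐ[k] ResidueField f x :=
  IsScalarTower.toAlgHom k (StalkRing f x) (ResidueField f x)

/-- A homomorphism from the local ring at `x`, as a morphism of the category of rings. -/
def ofStalkHom {R : Type u} [CommRing R] (x : X) (φ : StalkRing f x →+* R) :
    X.presheaf.stalk x ⟶ CommRingCat.of R :=
  CommRingCat.ofHom (R := X.presheaf.stalk x) φ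

theorem specMap_fromSpecStalk_comp {R : Type u} [CommRing R] [Algebra k R] (x : X)
    (φ : StalkRing f x →ₐ[k] R) :
    Spec.map (ofStalkHom f x φ.toRingHom) ≫ X.fromSpecStalk x ≫ f =
      Spec.map (CommRingCat.ofHom (algebraMap k R)) := by
  have hf : f = X.toSpecΓ ≫ Spec.map ((Scheme.ΓSpecIso (CommRingCat.of k)).inv ≫ f.appTop) := by
    rw [Spec.map_comp, ← Scheme.toSpecΓ_naturality_assoc, toSpecΓ_SpecMap_ΓSpecIso_inv,
      Category.comp_id]
  have e : X.fromSpecStalk x ≫ f = X.fromSpecStalk x ≫ X.toSpecΓ ≫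
      Spec.map ((Scheme.ΓSpecIso (CommRingCat.of k)).inv ≫ f.appTop) := congrArg _ hf
  rw [e, Scheme.fromSpecStalk_toSpecΓ_assoc, ← Spec.map_comp, ← Spec.map_comp]
  congr 1
  ext c
  exact φ.commutes c

/-- The constant map and the Taylor expansion, from the local ring at `x` to the jet ring, define by
the universal property of the fibre product a morphism to `X ×ₖ X`. It sends the closed point to
`Δ(x)`, and `θ` is the induced map on local rings. -/
theorem exists_diagonalStalk_hom (x : X) (n : ℕ) :
    ∃ θ : DiagonalStalk f x →+* JetRing (residueHom f x) n,
      (∀ a, θ (coprojection f _ (Limits.pullback.diagonal_fst f) x a) =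
        algebraMap _ _ (residueHom f x a)) ∧
      (∀ a, θ (coprojection f _ (Limits.pullback.diagonal_snd f) x a) =
        toJetRing (residueHom f x) n a) ∧
      ∀ z ∈ diagonalIdeal f x, jetEval (residueHom f x) n (θ z) = 0 := by
  let ε := residueHom f x
  let R := JetRing ε n
  let π : CommRingCat.of R ⟶ CommRingCat.of (ResidueField f x) :=
    CommRingCat.ofHom (jetEval ε n).toRingHom
  have hπ : IsLocalHom π.hom := isLocalHom_jetEval ε n
  let l : StalkRing f x →ₐ[k] R := ((Algebra.ofId (ResidueField f x) R).restrictScalars k).comp ε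
  let r : StalkRing f x →ₐ[k] R := toJetRing ε n
  let b := ofStalkHom f x ε.toRingHom
  let l' := ofStalkHom f x l.toRingHom
  let r' := ofStalkHom f x r.toRingHom
  have hl : l' ≫ π = b := by
    ext a
    change jetEval ε n (algebraMap _ _ (ε a)) = ε a
    rw [AlgHom.commutes]; rfl
  have hr : r' ≫ π = b := by
    ext a
    exact jetEval_toJetRing ε n a
  have hb : IsLocalHom b.hom :=
    inferInstanceAs (IsLocalHom (IsLocalRing.residue (StalkRing f x)))
  have hl' : IsLocalHom l'.hom := by
    have : IsLocalHom (π.hom.comp l'.hom) := by rw [← CommRingCat.hom_comp, hl]; exact hb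
    exact _root_.isLocalHom_of_comp l'.hom π.hom
  have hr' : IsLocalHom r'.hom := by
    have : IsLocalHom (π.hom.comp r'.hom) := by rw [← CommRingCat.hom_comp, hr]; exact hb
    exact _root_.isLocalHom_of_comp r'.hom π.hom
  let g : Spec (CommRingCat.of R) ⟶ Limits.pullback f f :=
    Limits.pullback.lift (Spec.map l' ≫ X.fromSpecStalk x) (Spec.map r' ≫ X.fromSpecStalk x) (by
      rw [Category.assoc, Category.assoc, specMap_fromSpecStalk_comp, specMap_fromSpecStalk_comp])
  let β := Spec.map b ≫ X.fromSpecStalk x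
  have hβ : β (closedPt (ResidueField f x)) = x :=
    specMap_fromSpecStalk_closedPt x b
  have hg : Spec.map π ≫ g = β ≫ Limits.pullback.diagonal f := by
    apply Limits.pullback.hom_ext
    · simp only [g, Category.assoc, Limits.pullback.lift_fst, Limits.pullback.diagonal_fst, β,
        Category.comp_id, ← hl, Spec.map_comp]
    · simp only [g, Category.assoc, Limits.pullback.lift_snd, Limits.pullback.diagonal_snd, β,
        Category.comp_id, ← hr, Spec.map_comp]
  have hcp : g (closedPt R) = Limits.pullback.diagonal f x := by
    rw [← specMap_closedPt π, ← Scheme.Hom.comp_apply, hg, Scheme.Hom.comp_apply, hβ]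
  refine ⟨(stalkTo g _ hcp).hom, fun a => ?_, fun a => ?_, fun z hz => ?_⟩
  · have h := stalkMap_stalkTo g _ hcp (Limits.pullback.fst f f) x
      (by rw [← Scheme.Hom.comp_apply, Limits.pullback.diagonal_fst]; rfl)
    simp only [g, Limits.pullback.lift_fst, stalkTo_specMap] at h
    exact congr($(h).hom a)
  · have h := stalkMap_stalkTo g _ hcp (Limits.pullback.snd f f) x
      (by rw [← Scheme.Hom.comp_apply, Limits.pullback.diagonal_snd]; rfl)
    simp only [g, Limits.pullback.lift_snd, stalkTo_specMap] at h
    exact congr($(h).hom a)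
  · have h := stalkTo_comp g _ hcp π (by rw [Scheme.Hom.comp_apply, specMap_closedPt, hcp])
    have h' := stalkMap_stalkTo β x hβ (Limits.pullback.diagonal f) _ rfl
    simp only [hg, ← h'] at h
    rw [TopCat.Presheaf.stalkSpecializes_refl, Category.id_comp] at h
    have h1 : jetEval ε n ((stalkTo g _ hcp).hom z) =
      (stalkTo β x hβ).hom (((Limits.pullback.diagonal f).stalkMap x).hom z) := congr($(h).hom z)
    rw [h1, show ((Limits.pullback.diagonal f).stalkMap x).hom z = 0 from hz, map_zero]

end TaylorMap

/-! ### Comparison of the Taylor map on fibres with jets -/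

namespace TaylorMap

variable {k : Type u} [Field k] {X : Scheme.{u}} (f : X ⟶ Spec (CommRingCat.of k))

theorem stalkSpecializes_stalkMap_of_eq_id {Y : Scheme.{u}} (q : Y ⟶ Y) (hq : q = 𝟙 Y) (x : Y)
    (h : q x = x) :
    Y.presheaf.stalkSpecializes (specializes_of_eq h) ≫ q.stalkMap x = 𝟙 _ := by
  subst hq
  refine TopCat.Presheaf.stalk_hom_ext _ fun U hU => ?_
  rw [TopCat.Presheaf.germ_stalkSpecializes_assoc, Scheme.Hom.germ_stalkMap]
  exact Category.id_comp _

theorem diagonal_stalkMap_coprojection (p : Limits.pullback f f ⟶ X)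
    (hp : Limits.pullback.diagonal f ≫ p = 𝟙 X) (x : X) (a : StalkRing f x) :
    ((Limits.pullback.diagonal f).stalkMap x).hom (coprojection f p hp x a) = a := by
  have h := stalkSpecializes_stalkMap_of_eq_id _ hp x (by rw [hp]; rfl)
  rw [Scheme.Hom.stalkMap_comp] at h
  exact congr($(h).hom a)

/-- The quotient map to the principal parts. -/
def toPrincipalParts (n : ℕ) (x : X) : DiagonalStalk f x →+* PrincipalParts f n x :=
  Ideal.Quotient.mk _

theorem map_toPrincipalParts_pow (n : ℕ) (x : X) :
    (diagonalIdeal f x).map (toPrincipalParts f n x) ^ (n + 1) = ⊥ := by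
  rw [← Ideal.map_pow]
  exact Ideal.map_quotient_self _

/-- Pure tensors in `𝒫ⁿ_{X/k}(M)_x`. -/
def pureTensor (n : ℕ) (M : X.Modules) (x : X) :
    PrincipalParts f n x →+ StalkModule f M x →+ PrincipalPartsModule f n M x where
  toFun p := (TensorProduct.mk (StalkRing f x) (PrincipalParts f n x)
    (StalkModule f M x) p).toAddMonoidHom
  map_zero' := by ext m; exact TensorProduct.zero_tmul _ _
  map_add' p q := by ext m; exact TensorProduct.add_tmul _ _ _

theorem smul_pureTensor {M : X.Modules} (n : ℕ) (x : X) (a : StalkRing f x)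
    (p : PrincipalParts f n x) (m : StalkModule f M x) :
    a • pureTensor f n M x p m = pureTensor f n M x (left f n x a * p) m := by
  change left f n x a • (p ⊗ₜ[StalkRing f x] m) = (left f n x a * p) ⊗ₜ[StalkRing f x] m
  rw [TensorProduct.smul_tmul', smul_eq_mul]

theorem pureTensor_smul {M : X.Modules} (n : ℕ) (x : X) (a : StalkRing f x)
    (p : PrincipalParts f n x) (m : StalkModule f M x) :
    pureTensor f n M x p (a • m) = pureTensor f n M x (right f n x a * p) m := by
  change p ⊗ₜ[StalkRing f x] (a • m) = (right f n x a * p) ⊗ₜ[StalkRing f x] m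
  rw [← TensorProduct.smul_tmul]
  rfl

theorem principalPartsModule_induction {M : X.Modules} {n : ℕ} {x : X}
    {motive : PrincipalPartsModule f n M x → Prop} (z : PrincipalPartsModule f n M x)
    (zero : motive 0) (add : ∀ y z, motive y → motive z → motive (y + z))
    (tmul : ∀ p m, motive (pureTensor f n M x p m)) : motive z :=
  TensorProduct.induction_on (motive := motive) z zero tmul add

/-- Additive maps out of `𝒫ⁿ_{X/k}(M)_x`. -/
def liftPrincipalParts {M : X.Modules} {n : ℕ} {x : X} {R : Type*} [AddCommGroup R]
    (F : PrincipalParts f n x →+ StalkModule f M x →+ R)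
    (hF : ∀ a p m, F (right f n x a * p) m = F p (a • m)) : PrincipalPartsModule f n M x →+ R :=
  TensorProduct.liftAddHom F hF

/-- The difference of the two coprojections of a function dies on the diagonal, so the ideal of `O_x
⊗ O_x` maps into the image of `I_Δ`, whose power `n + 1` is zero in the principal parts. -/
theorem exists_mulMap (n : ℕ) (x : X) :
    ∃ μ : StalkRing f x ⊗[k] StalkRing f x →+* PrincipalParts f n x,
      (∀ a b, μ (a ⊗ₜ b) = left f n x a * right f n x b) ∧
      ∀ w ∈ KaehlerDifferential.ideal k (StalkRing f x) ^ (n + 1), μ w = 0 := by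
  let _ : Algebra k (PrincipalParts f n x) :=
    ((left f n x).comp (algebraMap k (StalkRing f x))).toAlgebra
  let l : StalkRing f x →ₐ[k] PrincipalParts f n x := ⟨left f n x, fun _ => rfl⟩
  let r : StalkRing f x →ₐ[k] PrincipalParts f n x :=
    ⟨right f n x, fun c => (left_algebraMap f n x c).symm⟩
  let μ := Algebra.TensorProduct.lift l r fun _ _ => Commute.all _ _
  have hμ : ∀ a b, μ (a ⊗ₜ b) = left f n x a * right f n x b := fun a b =>
    Algebra.TensorProduct.lift_tmul ..
  refine ⟨μ.toRingHom, hμ, fun w hw => ?_⟩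
  have hle : (KaehlerDifferential.ideal k (StalkRing f x)).map μ.toRingHom ≤
      (diagonalIdeal f x).map (toPrincipalParts f n x) := by
    rw [← KaehlerDifferential.span_range_eq_ideal, Ideal.map_span, Ideal.span_le]
    rintro _ ⟨_, ⟨a, rfl⟩, rfl⟩
    have h1 : coprojection f _ (Limits.pullback.diagonal_snd f) x a -
        coprojection f _ (Limits.pullback.diagonal_fst f) x a ∈ diagonalIdeal f x := by
      rw [diagonalIdeal, RingHom.mem_ker, map_sub, diagonal_stalkMap_coprojection,
        diagonal_stalkMap_coprojection]
      exact sub_self _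
    have h2 := Ideal.mem_map_of_mem (toPrincipalParts f n x) h1
    rw [map_sub] at h2
    change μ (1 ⊗ₜ a - a ⊗ₜ 1) ∈ _
    rw [map_sub, hμ, hμ, map_one, map_one, one_mul, mul_one]
    exact h2
  have h := Ideal.mem_map_of_mem μ.toRingHom hw
  rw [Ideal.map_pow] at h
  have h' := Ideal.pow_right_mono hle (n + 1) h
  rw [map_toPrincipalParts_pow] at h'
  exact h'

variable {M : X.Modules} (V : Submodule k (GlobalSections f M)) {ι : Type*}

theorem taylorFibre_tmul (n : ℕ) (x : X) (c : ResidueField f x) (v : V) :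
    taylorFibre f V n x (c ⊗ₜ v) = c ⊗ₜ[StalkRing f x] jet f n M x v := by
  simp [taylorFibre, taylorStalk]

/-- The coordinates `ψ j` and the map `θ` send the fibre of the principal parts to jet rings, and
the image of a Taylor expansion is the jet of its coordinates. So vanishing of the former forces
vanishing of the latter. -/
theorem injective_taylorFibre_of_jetInjective (n : ℕ) (x : X)
    (ψ : ι → StalkModule f M x →ₗ[StalkRing f x] StalkRing f x)
    (φ : ι → V →ₗ[k] StalkRing f x) (hφ : ∀ j v, φ j v = ψ j (germ f M x v))
    (h : JetInjective (residueHom f x) φ n) : Function.Injective (taylorFibre f V n x) := by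
  obtain ⟨θ, hl, hr, hI⟩ := exists_diagonalStalk_hom f x n
  let R := JetRing (residueHom f x) n
  have hker : ∀ z ∈ diagonalIdeal f x ^ (n + 1), θ z = 0 := by
    intro z hz
    have hle : (diagonalIdeal f x).map θ ≤ RingHom.ker (jetEval (residueHom f x) n) := by
      rw [Ideal.map_le_iff_le_comap]
      exact fun z hz => hI z hz
    have h1 := Ideal.mem_map_of_mem θ hz
    rw [Ideal.map_pow] at h1
    simpa [ker_jetEval_pow] using Ideal.pow_right_mono hle (n + 1) h1
  let θ' : PrincipalParts f n x →+* R := Ideal.Quotient.lift _ θ hker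
  have hl' : ∀ a, θ' (left f n x a) = algebraMap (ResidueField f x) R (residueHom f x a) := hl
  have hr' : ∀ a, θ' (right f n x a) = toJetRing (residueHom f x) n a := hr
  let Θ : ι → PrincipalPartsModule f n M x →+ R := fun j =>
    liftPrincipalParts f
      ((AddMonoidHom.mul (R := R)).compl₂
        ((toJetRing (residueHom f x) n : StalkRing f x →+ R).comp
          (ψ j).toAddMonoidHom) |>.comp (θ' : PrincipalParts f n x →+ R))
      (fun a p m => by
        change θ' (right f n x a * p) * toJetRing _ n (ψ j m) =
          θ' p * toJetRing _ n (ψ j (a • m))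
        rw [map_mul, hr', map_smul, smul_eq_mul, map_mul]
        ring)
  have hΘ : ∀ j p (m : StalkModule f M x),
      Θ j (pureTensor f n M x p m) = θ' p * toJetRing (residueHom f x) n (ψ j m) := fun _ _ _ => rfl
  have hΘl : ∀ j a z, Θ j (a • z) = algebraMap _ R (residueHom f x a) * Θ j z := by
    intro j a z
    induction z using principalPartsModule_induction with
    | zero => rw [smul_zero, map_zero, mul_zero]
    | add y z hy hz => rw [smul_add, map_add, map_add, hy, hz, mul_add]
    | tmul p m => rw [smul_pureTensor, hΘ, hΘ, map_mul, hl', mul_assoc]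
  let Ξ : ι → ResidueField f x ⊗[StalkRing f x] PrincipalPartsModule f n M x →+ R := fun j =>
    TensorProduct.liftAddHom
      ((AddMonoidHom.mul (R := R)).compl₂ (Θ j) |>.comp
        (algebraMap (ResidueField f x) R : ResidueField f x →+ R))
      (fun a c z => by
        change algebraMap _ R (a • c) * Θ j z = algebraMap _ R c * Θ j (a • z)
        rw [hΘl, Algebra.smul_def, map_mul, mul_comm (algebraMap _ R _), mul_assoc]
        rfl)
  have hΞ : ∀ j t, Ξ j (taylorFibre f V n x t) =
      Ideal.Quotient.mk _ ((φ j).baseChange (ResidueField f x) t) := by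
    intro j t
    induction t with
    | zero => simp
    | add s t hs ht => rw [map_add, map_add, hs, ht, map_add, map_add]
    | tmul c v =>
      rw [taylorFibre_tmul]
      change algebraMap _ R c * (θ' 1 * toJetRing _ n (ψ j (germ f M x v))) = _
      rw [map_one, one_mul, ← hφ, LinearMap.baseChange_tmul]
      change Ideal.Quotient.mk _ ((c ⊗ₜ 1) * (1 ⊗ₜ φ j v)) = _
      rw [Algebra.TensorProduct.tmul_mul_tmul, one_mul, mul_one]
  rw [injective_iff_map_eq_zero]
  intro t ht
  refine h t fun j => ?_
  rw [← Ideal.Quotient.eq_zero_iff_mem, ← hΞ, ht, map_zero]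

/-- Conversely, the Taylor map is a sum of maps `g j` applied to the coordinates, and each `g j`
kills the power `n + 1` of the ideal of the point. -/
theorem jetInjective_of_injective_taylorFibre [Fintype ι] (n : ℕ) (x : X)
    (e : ι → StalkModule f M x)
    (φ : ι → V →ₗ[k] StalkRing f x) (hφ : ∀ v : V, ∑ j, φ j v • e j = germ f M x v)
    (h : Function.Injective (taylorFibre f V n x)) : JetInjective (residueHom f x) φ n := by
  obtain ⟨μ, hμ, hμI⟩ := exists_mulMap f n x
  let T := ResidueField f x ⊗[StalkRing f x] PrincipalPartsModule f n M x
  let E : ι → PrincipalParts f n x →+ PrincipalPartsModule f n M x := fun j =>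
    (pureTensor f n M x).flip (e j)
  have hE : ∀ j p, E j p = pureTensor f n M x p (e j) := fun _ _ => rfl
  have hEl : ∀ j a p, E j (left f n x a * p) = a • E j p := fun j a p =>
    (smul_pureTensor f n x a p (e j)).symm
  let g : ι → ResidueField f x ⊗[k] StalkRing f x →+ T := fun j =>
    TensorProduct.liftAddHom
      { toFun := fun c => (TensorProduct.mk (StalkRing f x) (ResidueField f x)
          (PrincipalPartsModule f n M x) c).toAddMonoidHom.comp
            ((E j).comp (right f n x : StalkRing f x →+ PrincipalParts f n x))
        map_zero' := by ext a; exact TensorProduct.zero_tmul _ _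
        map_add' := fun c d => by ext a; exact TensorProduct.add_tmul _ _ _ }
      (fun r c a => by
        change (r • c) ⊗ₜ[StalkRing f x] E j (right f n x a) =
          c ⊗ₜ[StalkRing f x] E j (right f n x (r • a))
        rw [Algebra.smul_def r a, map_mul, ← left_algebraMap, hEl, ← TensorProduct.smul_tmul,
          algebraMap_smul])
  have hg : ∀ j c a, g j (c ⊗ₜ a) = c ⊗ₜ E j (right f n x a) := fun _ _ _ => rfl
  have hgμ : ∀ j w, g j (mapLeft (residueHom f x) w) = 1 ⊗ₜ E j (μ w) := by
    intro j w
    induction w with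
    | zero => simp
    | add y z hy hz => simp only [map_add, hy, hz, TensorProduct.tmul_add]
    | tmul a b =>
      rw [mapLeft_tmul, hg, hμ, hEl, ← TensorProduct.smul_tmul, Algebra.smul_def, mul_one]
      rfl
  have hsum : ∀ t, taylorFibre f V n x t =
      ∑ j, g j ((φ j).baseChange (ResidueField f x) t) := by
    intro t
    induction t with
    | zero => simp
    | add s t hs ht => simp only [map_add, hs, ht, Finset.sum_add_distrib]
    | tmul c v =>
      rw [taylorFibre_tmul]
      simp only [LinearMap.baseChange_tmul, hg]
      rw [← TensorProduct.tmul_sum]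
      congr 1
      change pureTensor f n M x 1 (germ f M x v) = _
      rw [← hφ, map_sum]
      exact Finset.sum_congr rfl fun j _ => by rw [hE, pureTensor_smul, mul_one]
  intro t ht
  apply h
  rw [map_zero, hsum]
  refine Finset.sum_eq_zero fun j _ => ?_
  -- The residue field is a quotient of the local ring, so every element of the extended ideal is
  -- itself the image of an element of `I ^ (n + 1)`.
  have hsurj : Function.Surjective (mapLeft (residueHom f x)) :=
    TensorProduct.map_surjective (IsLocalRing.residue_surjective (R := StalkRing f x))
      Function.surjective_id
  have h1 := ht j
  rw [pointIdeal_eq_map, ← Ideal.map_pow, Ideal.mem_map_iff_of_surjective _ hsurj] at h1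
  obtain ⟨w, hw, hw'⟩ := h1
  rw [← hw', hgμ, hμI w hw, map_zero, TensorProduct.tmul_zero]

end TaylorMap

/-! ### Local frames of a locally free module -/

namespace TaylorMap

/-- A finite sum of copies of `N` is a retract of copies of `N` in the additive sense. -/
theorem exists_sum_comp_eq_id {C : Type*} [Category C] [Preadditive C] {β : Type*} [Fintype β]
    {N P : C} [Limits.HasCoproduct fun _ : β => N] (e : P ≅ ∐ fun _ : β => N) :
    ∃ (a : β → (P ⟶ N)) (b : β → (N ⟶ P)), ∑ j, a j ≫ b j = 𝟙 P := by
  classical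
  let F : β → C := fun _ => N
  have h : ∑ j, Limits.Sigma.π F j ≫ Limits.Sigma.ι F j = 𝟙 (∐ F) := by
    refine Limits.Sigma.hom_ext _ _ fun i => ?_
    rw [Preadditive.comp_sum, Finset.sum_eq_single i]
    · simp
    · intro j _ hj
      rw [Limits.Sigma.ι_π_of_ne_assoc _ hj.symm, Limits.zero_comp]
    · simp
  refine ⟨fun j => e.hom ≫ Limits.Sigma.π F j, fun j => Limits.Sigma.ι F j ≫ e.inv, ?_⟩
  have h2 : ∀ j, (e.hom ≫ Limits.Sigma.π F j) ≫ Limits.Sigma.ι F j ≫ e.inv =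
      e.hom ≫ (Limits.Sigma.π F j ≫ Limits.Sigma.ι F j) ≫ e.inv := fun j => by
    simp only [Category.assoc]
  rw [Finset.sum_congr rfl fun j _ => h2 j, ← Preadditive.comp_sum, ← Preadditive.sum_comp, h,
    Category.id_comp, e.hom_inv_id]

/-- The structure sheaf as a module over itself. -/
def unitModule (U : Scheme.{u}) : U.Modules := SheafOfModules.unit U.ringCatSheaf

/-- Sections of the structure sheaf as a module. -/
def unitSections (U : Scheme.{u}) (W : U.Opens) : Γ(unitModule U, W) ≃+ Γ(U, W) := AddEquiv.refl _

theorem unitSections_smul {U : Scheme.{u}} {W : U.Opens} (r : Γ(U, W)) (m : Γ(unitModule U, W)) :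
    unitSections U W (r • m) = r * unitSections U W m := rfl

theorem unitSections_map {U : Scheme.{u}} {W W' : U.Opens} (i : W' ⟶ W) (m : Γ(unitModule U, W)) :
    unitSections U W' ((unitModule U).presheaf.map i.op m) =
      U.presheaf.map i.op (unitSections U W m) := rfl

variable {X : Scheme.{u}}

/-- Of the isomorphism with a free module only this relation is kept: it passes to sections and
stalks without any description of the sections of a coproduct of sheaves. -/
theorem exists_local_frame {M : X.Modules} (hM : IsLocallyFreeOfFiniteRank M) (x : X) :
    ∃ U : X.Opens, x ∈ U ∧ ∃ r : ℕ,
      ∃ (a : ULift.{u} (Fin r) → (M.restrict U.ι ⟶ unitModule U))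
        (b : ULift.{u} (Fin r) → (unitModule U ⟶ M.restrict U.ι)),
        ∑ j, a j ≫ b j = 𝟙 _ := by
  obtain ⟨U, hx, r, ⟨e⟩⟩ := hM x
  exact ⟨U, hx, r, exists_sum_comp_eq_id (C := U.toScheme.Modules) (N := unitModule U) e⟩

theorem sum_app {U : Scheme.{u}} {M N : U.Modules} {β : Type*} (s : Finset β)
    (g : β → (M ⟶ N)) (W : U.Opens) (m : Γ(M, W)) :
    (∑ j ∈ s, g j).app W m = ∑ j ∈ s, (g j).app W m := by
  classical
  induction s using Finset.induction_on with
  | empty => rfl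
  | insert a s ha ih =>
    rw [Finset.sum_insert ha, Finset.sum_insert ha, ← ih]
    rfl

theorem app_map {U : Scheme.{u}} {M N : U.Modules} (g : M ⟶ N) {W W' : U.Opens}
    (i : W' ⟶ W) (m : Γ(M, W)) :
    g.app W' (M.presheaf.map i.op m) = N.presheaf.map i.op (g.app W m) :=
  (congr($(g.mapPresheaf.naturality i.op) m))

theorem restrict_smul (M : X.Modules) (U : X.Opens) (W : U.toScheme.Opens)
    (r : Γ(X, U.ι ''ᵁ W)) (m : Γ(M, U.ι ''ᵁ W)) :
    (show Γ(M.restrict U.ι, W) from r • m) =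
      (show Γ(U.toScheme, W) from r) • (show Γ(M.restrict U.ι, W) from m) := by
  change r • m = (U.ι.appIso W).inv r • m
  rw [Scheme.Opens.ι_appIso]
  rfl

section Coordinates

variable {M : X.Modules} {U : X.Opens} {W W' : U.toScheme.Opens}

/-- The coordinate of a section given by a homomorphism to the structure sheaf. -/
def coord (a : M.restrict U.ι ⟶ unitModule U) (W : U.toScheme.Opens) :
    Γ(M, U.ι ''ᵁ W) →+ Γ(X, U.ι ''ᵁ W) :=
  (unitSections U W).toAddMonoidHom.comp (a.app W).hom

theorem coord_smul (a : M.restrict U.ι ⟶ unitModule U) (r : Γ(X, U.ι ''ᵁ W))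
    (m : Γ(M, U.ι ''ᵁ W)) : coord a W (r • m) = r * coord a W m := by
  have h := congrArg (a.app W) (restrict_smul M U W r m)
  rw [Scheme.Modules.Hom.app_smul] at h
  exact h

theorem coord_map (a : M.restrict U.ι ⟶ unitModule U) (i : W' ⟶ W) (m : Γ(M, U.ι ''ᵁ W)) :
    coord a W' (M.presheaf.map (U.ι.opensFunctor.map i).op m) =
      X.presheaf.map (U.ι.opensFunctor.map i).op (coord a W m) :=
  app_map a i m

/-- The section given by a homomorphism from the structure sheaf. -/
def frame (b : unitModule U ⟶ M.restrict U.ι) : Γ(M, U.ι ''ᵁ ⊤) :=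
  b.app ⊤ ((unitSections U ⊤).symm 1)

theorem sum_coord_smul_frame {β : Type*} [Fintype β] (a : β → (M.restrict U.ι ⟶ unitModule U))
    (b : β → (unitModule U ⟶ M.restrict U.ι)) (h : ∑ j, a j ≫ b j = 𝟙 _)
    (m : Γ(M, U.ι ''ᵁ W)) :
    ∑ j, coord (a j) W m • M.presheaf.map (U.ι.opensFunctor.map (homOfLE le_top : W ⟶ ⊤)).op
      (frame (b j)) = m := by
  have h1 : ∀ j, coord (a j) W m • M.presheaf.map
      (U.ι.opensFunctor.map (homOfLE le_top : W ⟶ ⊤)).op (frame (b j)) =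
      (a j ≫ b j).app W m := by
    intro j
    have h2 := app_map (b j) (homOfLE le_top : W ⟶ ⊤) ((unitSections U ⊤).symm 1)
    have h3 : (unitModule U).presheaf.map (homOfLE le_top : W ⟶ ⊤).op
        ((unitSections U ⊤).symm 1) = (unitSections U W).symm 1 := by
      apply (unitSections U W).injective
      rw [unitSections_map, AddEquiv.apply_symm_apply, AddEquiv.apply_symm_apply, map_one]
    rw [h3] at h2
    refine (restrict_smul M U W _ _).trans ?_
    have h4 := Scheme.Modules.Hom.app_smul (b j) (coord (a j) W m : Γ(U.toScheme, W))
      ((unitSections U W).symm 1)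
    refine Eq.trans ?_ (h4.symm.trans ?_)
    · rw [h2]; rfl
    · change (b j).app W _ = (b j).app W ((a j).app W m)
      congr 1
      apply (unitSections U W).injective
      refine (unitSections_smul _ _).trans ?_
      rw [AddEquiv.apply_symm_apply]
      exact mul_one _
  rw [Finset.sum_congr rfl fun j _ => h1 j]
  refine (sum_app Finset.univ (fun j => a j ≫ b j) W m).symm.trans ?_
  rw [h]
  rfl

end Coordinates

/-- A compatible family of homomorphisms on sections induces a homomorphism on the stalk. -/
theorem exists_stalk_desc (F : TopCat.Presheaf Ab.{u} X) (x : X) (O : Type u) [AddCommGroup O]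
    (L : ∀ V : X.Opens, x ∈ V → F.obj (.op V) →+ O)
    (hL : ∀ (V W : X.Opens) (i : V ⟶ W) (hx : x ∈ V) (m : F.obj (.op W)),
      L V hx (F.map i.op m) = L W (i.le hx) m) :
    ∃ ψ : F.stalk x →+ O, ∀ (V : X.Opens) (hx : x ∈ V) (m : F.obj (.op V)),
      ψ (F.germ V x hx m) = L V hx m := by
  let c : Limits.Cocone ((TopologicalSpace.OpenNhds.inclusion x).op ⋙ F) :=
    { pt := AddCommGrpCat.of O
      ι :=
        { app := fun V => AddCommGrpCat.ofHom (L V.unop.1 V.unop.2)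
          naturality := fun V W i => by
            ext m
            exact hL _ _ ((TopologicalSpace.OpenNhds.inclusion x).map i.unop) _ m } }
  refine ⟨(Limits.colimit.desc _ c).hom, fun V hx m => ?_⟩
  exact congr($(Limits.colimit.ι_desc c (.op ⟨V, hx⟩)) m)

end TaylorMap

/-! ### Coordinates on stalks and on affine open subsets -/

namespace TaylorMap

variable {k : Type u} [Field k] {X : Scheme.{u}} (f : X ⟶ Spec (CommRingCat.of k))

/-- The functions on an open subset of a `k`-scheme, as a `k`-algebra. -/
def Sections (_f : X ⟶ Spec (CommRingCat.of k)) (W : X.Opens) : Type u := Γ(X, W)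

instance (W : X.Opens) : CommRing (Sections f W) := inferInstanceAs (CommRing Γ(X, W))

instance (W : X.Opens) : Algebra k (Sections f W) :=
  ((X.presheaf.map (homOfLE le_top : W ⟶ ⊤).op).hom.comp (structureMap f)).toAlgebra

/-- The germ at a point of a function on an open subset. -/
def germFunction (W : X.Opens) (y : X) (hy : y ∈ W) : Γ(X, W) →+* StalkRing f y :=
  (X.presheaf.germ W y hy).hom

theorem germFunction_map {W W' : X.Opens} (i : W' ⟶ W) (y : X) (hy : y ∈ W') (s : Γ(X, W)) :
    germFunction f W' y hy (X.presheaf.map i.op s) = germFunction f W y (i.le hy) s :=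
  TopCat.Presheaf.germ_res_apply X.presheaf i y hy s

/-- The germ at a point of an open subset, as a homomorphism of `k`-algebras. -/
def germSections (W : X.Opens) (y : X) (hy : y ∈ W) : Sections f W →ₐ[k] StalkRing f y :=
  { germFunction f W y hy with
    commutes' := fun c => germFunction_map f (homOfLE le_top : W ⟶ ⊤) y hy (structureMap f c) }

variable {M : X.Modules}

/-- The germ at a point of a section on an open subset. -/
def germSection (M : X.Modules) (W : X.Opens) (y : X) (hy : y ∈ W) :
    Γ(M, W) →+ StalkModule f M y :=
  (M.presheaf.germ W y hy).hom

theorem germSection_map {W W' : X.Opens} (i : W' ⟶ W) (y : X) (hy : y ∈ W') (m : Γ(M, W)) :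
    germSection f M W' y hy (M.presheaf.map i.op m) = germSection f M W y (i.le hy) m :=
  TopCat.Presheaf.germ_res_apply M.presheaf i y hy m

theorem germSection_smul (W : X.Opens) (y : X) (hy : y ∈ W) (s : Γ(X, W)) (m : Γ(M, W)) :
    germSection f M W y hy (s • m) = germFunction f W y hy s • germSection f M W y hy m :=
  PresheafOfModules.germ_smul (R := X.presheaf) M.val y W hy s m

theorem exists_stalk_coord {U : X.Opens} {β : Type*} [Fintype β]
    (a : β → (M.restrict U.ι ⟶ unitModule U)) (b : β → (unitModule U ⟶ M.restrict U.ι))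
    (h : ∑ j, a j ≫ b j = 𝟙 _) (y : X) (hy : y ∈ U) :
    ∃ (e : β → StalkModule f M y) (ψ : β → StalkModule f M y →ₗ[StalkRing f y] StalkRing f y),
      (∀ m, ∑ j, ψ j m • e j = m) ∧
      ∀ j (W : U.toScheme.Opens) (hW : y ∈ U.ι ''ᵁ W) (m : Γ(M, U.ι ''ᵁ W)),
        ψ j (germSection f M _ y hW m) = germFunction f _ y hW (coord (a j) W m) := by
  have hmem : ∀ V : X.Opens, y ∈ V → y ∈ U.ι ''ᵁ (U.ι ⁻¹ᵁ V) := fun V hV =>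
    ⟨⟨y, hy⟩, hV, rfl⟩
  let L : β → ∀ V : X.Opens, y ∈ V → Γ(M, V) →+ StalkRing f y := fun j V hV =>
    (germFunction f _ y (hmem V hV)).toAddMonoidHom.comp
      ((coord (a j) (U.ι ⁻¹ᵁ V)).comp
        (M.presheaf.map (homOfLE (U.ι.image_preimage_le V)).op).hom)
  have hLdef : ∀ j V hV m, L j V hV m = germFunction f _ y (hmem V hV)
      (coord (a j) (U.ι ⁻¹ᵁ V) (M.presheaf.map (homOfLE (U.ι.image_preimage_le V)).op m)) :=
    fun _ _ _ _ => rfl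
  have hL : ∀ j (V W : X.Opens) (i : V ⟶ W) (hx : y ∈ V) (m : Γ(M, W)),
      L j V hx (M.presheaf.map i.op m) = L j W (i.le hx) m := by
    intro j V W i hx m
    let i' : U.ι ⁻¹ᵁ V ⟶ U.ι ⁻¹ᵁ W := (TopologicalSpace.Opens.map U.ι.base).map i
    have h1 := coord_map (a j) i' (M.presheaf.map (homOfLE (U.ι.image_preimage_le W)).op m)
    have h2 : M.presheaf.map (homOfLE (U.ι.image_preimage_le V)).op (M.presheaf.map i.op m) =
        M.presheaf.map (U.ι.opensFunctor.map i').op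
          (M.presheaf.map (homOfLE (U.ι.image_preimage_le W)).op m) := by
      rw [← ConcreteCategory.comp_apply, ← ConcreteCategory.comp_apply, ← Functor.map_comp,
        ← Functor.map_comp]
      rfl
    rw [hLdef j V hx, hLdef j W (i.le hx), h2, h1]
    exact germFunction_map f (U.ι.opensFunctor.map i') y _ _
  choose ψ₀ hψ₀ using fun j => exists_stalk_desc M.presheaf y (StalkRing f y) (L j) (hL j)
  have hψ : ∀ j (W : U.toScheme.Opens) (hW : y ∈ U.ι ''ᵁ W) (m : Γ(M, U.ι ''ᵁ W)),
      ψ₀ j (germSection f M _ y hW m) = germFunction f _ y hW (coord (a j) W m) := by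
    intro j W hW m
    let i : U.ι ⁻¹ᵁ (U.ι ''ᵁ W) ⟶ W := homOfLE (U.ι.preimage_image_eq W).le
    have h1 := coord_map (a j) i m
    refine (hψ₀ j _ hW m).trans ((hLdef j _ hW m).trans ?_)
    rw [← germFunction_map f (U.ι.opensFunctor.map i) y (hmem _ hW), ← h1]
    rfl
  -- Linearity of `ψ₀ j` is checked on germs, for which `m` and `s` must be represented on one open
  -- subset of `U`.
  have hrep : ∀ m : StalkModule f M y, ∀ s : StalkRing f y, ∃ (W : U.toScheme.Opens)
      (hW : y ∈ U.ι ''ᵁ W) (m' : Γ(M, U.ι ''ᵁ W)) (s' : Γ(X, U.ι ''ᵁ W)),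
      germSection f M _ y hW m' = m ∧ germFunction f _ y hW s' = s := by
    intro m s
    obtain ⟨V₁, hV₁, m₁, rfl⟩ := TopCat.Presheaf.exists_germ_eq M.presheaf m
    obtain ⟨V₂, hV₂, s₂, rfl⟩ := TopCat.Presheaf.exists_germ_eq X.presheaf s
    have hle := U.ι.image_preimage_le (V₁ ⊓ V₂)
    refine ⟨U.ι ⁻¹ᵁ (V₁ ⊓ V₂), hmem _ ⟨hV₁, hV₂⟩,
      M.presheaf.map (homOfLE (hle.trans inf_le_left)).op m₁,
      X.presheaf.map (homOfLE (hle.trans inf_le_right)).op s₂, ?_, ?_⟩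
    · exact germSection_map ..
    · exact germFunction_map ..
  refine ⟨fun j => germSection f M _ y (show y ∈ U.ι ''ᵁ ⊤ from ⟨⟨y, hy⟩, trivial, rfl⟩)
    (frame (b j)), fun j => { ψ₀ j with map_smul' := fun s m => ?_ }, fun m => ?_, hψ⟩
  · obtain ⟨W, hW, m, s, rfl, rfl⟩ := hrep m s
    change ψ₀ j (germFunction f _ y hW s • germSection f M _ y hW m) =
      germFunction f _ y hW s * ψ₀ j (germSection f M _ y hW m)
    rw [← germSection_smul, hψ, hψ, coord_smul, map_mul]
  · obtain ⟨W, hW, m, s, rfl, -⟩ := hrep m 0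
    change ∑ j, ψ₀ j (germSection f M _ y hW m) • _ = _
    conv_rhs => rw [← sum_coord_smul_frame a b h m]
    rw [map_sum]
    refine Finset.sum_congr rfl fun j _ => ?_
    rw [germSection_smul, germSection_map, hψ]

/-- The same functions `φ j v` give the coordinates at every point of `W`; this is what allows jets
at different points to be compared. -/
theorem exists_affine_frame (hM : IsLocallyFreeOfFiniteRank M)
    (V : Submodule k (GlobalSections f M)) (x : X) :
    ∃ W : X.Opens, IsAffineOpen W ∧ x ∈ W ∧ ∃ (r : ℕ) (φ : Fin r → V →ₗ[k] Sections f W),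
      ∀ y (hy : y ∈ W), ∃ (e : Fin r → StalkModule f M y)
        (ψ : Fin r → StalkModule f M y →ₗ[StalkRing f y] StalkRing f y),
        (∀ m, ∑ j, ψ j m • e j = m) ∧
        ∀ j (v : V), ψ j (germ f M y v) = germSections f W y hy (φ j v) := by
  obtain ⟨U, hx, r, a, b, h⟩ := exists_local_frame hM x
  obtain ⟨W', hW', hxW', -⟩ := exists_isAffineOpen_mem_and_subset (X := U.toScheme)
    (x := ⟨x, hx⟩) (U := ⊤) trivial
  let i : U.ι ''ᵁ W' ⟶ ⊤ := homOfLE le_top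
  let φ : ULift.{u} (Fin r) → V →ₗ[k] Sections f (U.ι ''ᵁ W') := fun j =>
    { toFun := fun v => coord (a j) W' (M.presheaf.map i.op v.1)
      map_add' := fun v w =>
        map_add ((coord (a j) W').comp (M.presheaf.map i.op).hom) (v.1 : Γ(M, ⊤)) w.1
      map_smul' := fun c v =>
        (congrArg (coord (a j) W') (M.map_smul i (structureMap f c) (v.1 : Γ(M, ⊤)))).trans
          (coord_smul (a j) (X.presheaf.map i.op (structureMap f c)) (M.presheaf.map i.op v.1)) }
  refine ⟨U.ι ''ᵁ W', hW'.image_of_isOpenImmersion U.ι, ⟨⟨x, hx⟩, hxW', rfl⟩, r,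
    fun j => φ ⟨j⟩, fun y hy => ?_⟩
  obtain ⟨z, hz, rfl⟩ := id hy
  obtain ⟨e, ψ, he, hψ⟩ := exists_stalk_coord f a b h z.1 z.2
  refine ⟨fun j => e ⟨j⟩, fun j => ψ ⟨j⟩, fun m => ?_, fun j v => ?_⟩
  · conv_rhs => rw [← he m]
    exact (Equiv.ulift (α := Fin r)).symm.sum_comp fun j => ψ j m • e j
  · have h1 := germSection_map f (M := M) i z.1 hy v.1
    have h2 := hψ ⟨j⟩ W' hy (M.presheaf.map i.op v.1)
    rw [h1] at h2
    exact h2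

end TaylorMap

/-! ### Noetherian induction and the two assertions -/

namespace TaylorMap

/-- Noetherian induction: a property with a monotone bound, which spreads out along
specializations from each point, is uniformly bounded. -/
theorem exists_uniform_bound {α : Type*} [TopologicalSpace α] [TopologicalSpace.NoetherianSpace α]
    [QuasiSober α] {P : ℕ → α → Prop} (hmono : ∀ n m x, n ≤ m → P n x → P m x)
    (hP : ∀ x, ∃ N, ∃ U : Set α, IsOpen U ∧ x ∈ U ∧ ∀ y ∈ U, x ⤳ y → P N y) :
    ∃ N, ∀ y, P N y := by
  have hwf : WellFoundedLT (TopologicalSpace.Closeds α) :=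
    ((TopologicalSpace.noetherianSpace_TFAE α).out 0 1 :).mp ‹_›
  suffices h : ∀ C : TopologicalSpace.Closeds α, ∃ N, ∀ y ∈ C, P N y by
    obtain ⟨N, hN⟩ := h ⊤
    exact ⟨N, fun y => hN y trivial⟩
  intro C
  induction C using hwf.induction with
  | ind C ih =>
    obtain ⟨S, hS, hclosed, hirr, hC⟩ :=
      TopologicalSpace.NoetherianSpace.exists_finite_set_isClosed_irreducible C.isClosed
    have hZ : ∀ Z ∈ S, ∃ N, ∀ y ∈ Z, P N y := by
      intro Z hZS
      have hZC : Z ⊆ C := hC ▸ Set.subset_sUnion_of_mem hZS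
      -- The generic point of `Z` specializes to all of `Z`, so its bound holds on `Z ∩ U`; the rest
      -- `Z \ U` is closed and misses `x`, hence is strictly smaller than `C`.
      obtain ⟨x, hx⟩ := QuasiSober.sober (hirr Z hZS) (hclosed Z hZS)
      obtain ⟨N, U, hU, hxU, hN⟩ := hP x
      have hxZ : x ∈ Z := hx.mem
      obtain ⟨N', hN'⟩ := ih ⟨Z \ U, (hclosed Z hZS).sdiff hU⟩ (by
        refine lt_of_le_of_ne (fun y hy => hZC hy.1) fun h => ?_
        have : x ∈ Z \ U := by
          change x ∈ (⟨Z \ U, (hclosed Z hZS).sdiff hU⟩ : TopologicalSpace.Closeds α)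
          rw [h]
          exact hZC hxZ
        exact this.2 hxU)
      refine ⟨max N N', fun y hy => ?_⟩
      by_cases hyU : y ∈ U
      · exact hmono _ _ _ (le_max_left _ _) (hN y hyU (hx.specializes hy))
      · exact hmono _ _ _ (le_max_right _ _) (hN' y ⟨hy, hyU⟩)
    choose! N hN using hZ
    obtain ⟨B, hB⟩ := (hS.image N).bddAbove
    refine ⟨B, fun y hy => ?_⟩
    obtain ⟨Z, hZS, hyZ⟩ : y ∈ ⋃₀ S := hC ▸ hy
    exact hmono _ _ _ (hB ⟨Z, hZS, rfl⟩) (hN Z hZS y hyZ)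

variable {k : Type u} [Field k] {X : Scheme.{u}} (f : X ⟶ Spec (CommRingCat.of k))

theorem finiteType_sections [LocallyOfFiniteType f] {W : X.Opens} (hW : IsAffineOpen W) :
    Algebra.FiniteType k (Sections f W) := by
  have h1 := LocallyOfFiniteType.finiteType_appLE f (isAffineOpen_top (Spec (CommRingCat.of k)))
    hW le_top
  have h2 : (Scheme.ΓSpecIso (CommRingCat.of k)).inv.hom.FiniteType :=
    RingHom.FiniteType.of_surjective _
      (Scheme.ΓSpecIso (CommRingCat.of k)).symm.commRingCatIsoToRingEquiv.surjective
  exact h1.comp h2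

theorem isUnit_iff_residueHom_ne_zero (x : X) (a : StalkRing f x) :
    IsUnit a ↔ residueHom f x a ≠ 0 :=
  (IsLocalRing.residue_ne_zero_iff_isUnit a).symm

theorem mem_basicOpen_iff {W : X.Opens} {y : X} (hy : y ∈ W) (s : Sections f W) :
    y ∈ X.basicOpen (U := W) s ↔ residueHom f y (germSections f W y hy s) ≠ 0 := by
  rw [← isUnit_iff_residueHom_ne_zero]
  exact Scheme.mem_basicOpen X (U := W) s y hy

theorem exists_isLocalization {W : X.Opens} (hW : IsAffineOpen W) {y : X} (hy : y ∈ W) :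
    ∃ S : Submonoid (Sections f W),
      letI := (germSections f W y hy).toRingHom.toAlgebra
      IsLocalization S (StalkRing f y) :=
  ⟨(hW.primeIdealOf ⟨y, hy⟩).asIdeal.primeCompl, hW.isLocalization_stalk ⟨y, hy⟩⟩

variable {M : X.Modules} (V : Submodule k (GlobalSections f M))

/-- The stalk is a localization of the ring of the affine open subset, so the two comparisons over
the local ring descend to that ring. -/
theorem injective_taylorFibre_iff {W : X.Opens} (hW : IsAffineOpen W) {y : X} (hy : y ∈ W)
    {ι : Type*} [Fintype ι] (φ : ι → V →ₗ[k] Sections f W) (e : ι → StalkModule f M y)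
    (ψ : ι → StalkModule f M y →ₗ[StalkRing f y] StalkRing f y) (he : ∀ m, ∑ j, ψ j m • e j = m)
    (hψ : ∀ j (v : V), ψ j (germ f M y v) = germSections f W y hy (φ j v)) (n : ℕ) :
    Function.Injective (taylorFibre f V n y) ↔
      JetInjective ((residueHom f y).comp (germSections f W y hy)) φ n := by
  constructor
  · intro h
    refine JetInjective.to_isLocalization _ _ φ n ?_
    refine jetInjective_of_injective_taylorFibre f V n y e _ (fun v => ?_) h
    conv_rhs => rw [← he (germ f M y v)]
    exact Finset.sum_congr rfl fun j _ => by rw [hψ]; rfl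
  · intro h
    let _ := (germSections f W y hy).toRingHom.toAlgebra
    have : IsScalarTower k (Sections f W) (StalkRing f y) :=
      IsScalarTower.of_algebraMap_eq fun c => ((germSections f W y hy).commutes c).symm
    obtain ⟨S, hS⟩ := exists_isLocalization f hW hy
    refine injective_taylorFibre_of_jetInjective f V n y ψ _ (fun j v => (hψ j v).symm)
      (JetInjective.of_isLocalization S (residueHom f y) φ n h)

theorem exists_residueHom_eq_div {W : X.Opens} (hW : IsAffineOpen W) {x : X} (hx : x ∈ W)
    (c : ResidueField f x) :
    ∃ a s : Sections f W, residueHom f x (germSections f W x hx s) ≠ 0 ∧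
      c * residueHom f x (germSections f W x hx s) = residueHom f x (germSections f W x hx a) := by
  obtain ⟨c, rfl⟩ := IsLocalRing.residue_surjective c
  let _ := (germSections f W x hx).toRingHom.toAlgebra
  obtain ⟨S, hS⟩ := exists_isLocalization f hW hx
  obtain ⟨⟨a, s⟩, h⟩ := IsLocalization.surj S c
  refine ⟨a, s, ?_, ?_⟩
  · rw [← isUnit_iff_residueHom_ne_zero]
    exact IsLocalization.map_units (StalkRing f x) s
  · exact (map_mul (residueHom f x) c _).symm.trans (congrArg (residueHom f x) h)

theorem exists_open_forall_injective [LocallyOfFiniteType f] (hM : IsLocallyFreeOfFiniteRank M)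
    [FiniteDimensional k V] (x : X) (n : ℕ) (h : Function.Injective (taylorFibre f V n x)) :
    ∃ U : Set X, IsOpen U ∧ x ∈ U ∧ ∀ y ∈ U, x ⤳ y → Function.Injective (taylorFibre f V n y) := by
  obtain ⟨W, hW, hx, r, φ, hφ⟩ := exists_affine_frame f hM V x
  have := finiteType_sections f hW
  obtain ⟨e, ψ, he, hψ⟩ := hφ x hx
  rw [injective_taylorFibre_iff f V hW hx φ e ψ he hψ] at h
  obtain ⟨s, hs, hspread⟩ := h.exists_spread _ (exists_residueHom_eq_div f hW hx)
  refine ⟨X.basicOpen (U := W) s, (X.basicOpen (U := W) s).isOpen,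
    (mem_basicOpen_iff f hx s).mpr hs, fun y hys hxy => ?_⟩
  have hy : y ∈ W := X.basicOpen_le (U := W) s hys
  obtain ⟨e', ψ', he', hψ'⟩ := hφ y hy
  rw [injective_taylorFibre_iff f V hW hy φ e' ψ' he' hψ']
  refine hspread _ _ _ _ (fun a ha => ?_) ((mem_basicOpen_iff f hy s).mp hys)
  -- A function that is nonzero at `y` is nonzero on a neighbourhood of `y`, which contains the
  -- generization `x`.
  by_contra hne
  exact (mem_basicOpen_iff f hx a).mp
    (hxy.mem_open (X.basicOpen (U := W) a).isOpen ((mem_basicOpen_iff f hy a).mpr hne)) ha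

/-- For jets this is the inclusion between powers of the ideal of the point. -/
theorem injective_taylorFibre_mono (hM : IsLocallyFreeOfFiniteRank M) (x : X) {n m : ℕ}
    (hnm : n ≤ m) (h : Function.Injective (taylorFibre f V n x)) :
    Function.Injective (taylorFibre f V m x) := by
  obtain ⟨W, hW, hx, r, φ, hφ⟩ := exists_affine_frame f hM V x
  obtain ⟨e, ψ, he, hψ⟩ := hφ x hx
  rw [injective_taylorFibre_iff f V hW hx φ e ψ he hψ] at h ⊢
  exact h.mono hnm

theorem injectivityOrder_lt_top [LocallyOfFiniteType f] [QuasiCompact f]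
    (hM : IsLocallyFreeOfFiniteRank M) [FiniteDimensional k V] (hV : IsSeparatedSubspace f V) :
    injectivityOrder f V < ⊤ := by
  have := LocallyOfFiniteType.isLocallyNoetherian f
  have : CompactSpace X := QuasiCompact.compactSpace_of_compactSpace f
  have : IsNoetherian X := {}
  obtain ⟨N, hN⟩ := exists_uniform_bound (α := X)
    (P := fun n x => Function.Injective (taylorFibre f V n x))
    (fun n m x hnm h => injective_taylorFibre_mono f V hM x hnm h) fun x => by
      obtain ⟨N, hN⟩ := hV x
      exact ⟨N, exists_open_forall_injective f V hM x N (hN N le_rfl)⟩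
  refine lt_of_le_of_lt (iSup_le fun x => sInf_le ⟨N, rfl, hN x⟩) (ENat.natCast_lt_top N)

theorem isSeparatedAt_of_injOn_germ [LocallyOfFiniteType f] [IsReduced X] [IsAlgClosed k]
    (hM : IsLocallyFreeOfFiniteRank M) [FiniteDimensional k V] (x : X)
    (hV : Set.InjOn (germ f M x) V) : IsSeparatedAt f V x := by
  obtain ⟨W, hW, hx, r, φ, hφ⟩ := exists_affine_frame f hM V x
  obtain ⟨e, ψ, he, hψ⟩ := hφ x hx
  have hfin := finiteType_sections f hW
  let _ := (germSections f W x hx).toRingHom.toAlgebra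
  have : IsScalarTower k (Sections f W) (StalkRing f x) :=
    IsScalarTower.of_algebraMap_eq fun c => ((germSections f W x hx).commutes c).symm
  obtain ⟨S, hS⟩ := exists_isLocalization f hW hx
  have h1 : Algebra.EssFiniteType (Sections f W) (StalkRing f x) :=
    Algebra.EssFiniteType.of_isLocalization _ S
  have : Algebra.EssFiniteType k (StalkRing f x) := Algebra.EssFiniteType.comp k (Sections f W) _
  have : _root_.IsReduced (StalkRing f x) :=
    inferInstanceAs (_root_.IsReduced (X.presheaf.stalk x))
  obtain ⟨N, hN⟩ := exists_forall_jetInjective (residueHom f x)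
    -- In a local ring an element with nonzero residue is a unit, so no proper ideal contains it.
    (fun P hP a ha => by
      rw [RingHom.mem_ker]
      by_contra hne
      exact hP.ne_top (Ideal.eq_top_of_isUnit_mem P ha
        ((isUnit_iff_residueHom_ne_zero f x a).mpr hne)))
    (fun j => (germSections f W x hx).toLinearMap ∘ₗ φ j)
    (fun v hv => by
      apply Subtype.ext
      apply hV v.2 V.zero_mem
      rw [map_zero, ← he (germ f M x v)]
      refine Finset.sum_eq_zero fun j _ => ?_
      rw [hψ]
      exact (congrArg (· • e j) (hv j)).trans (zero_smul _ _))
  exact ⟨N, fun n hn => injective_taylorFibre_of_jetInjective f V n x ψ _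
    (fun j v => (hψ j v).symm) (hN n hn)⟩

end TaylorMap

end

theorem mainTheorem4 {k : Type u} [Field k] [CharZero k] {X : Scheme.{u}}
    (f : X ⟶ Spec (CommRingCat.of k)) [LocallyOfFiniteType f] [IsReduced X]
    (M : X.Modules) (hM : TaylorMap.IsLocallyFreeOfFiniteRank M)
    (V : Submodule k (TaylorMap.GlobalSections f M)) [FiniteDimensional k V] :
    (QuasiCompact f → TaylorMap.IsSeparatedSubspace f V →
      TaylorMap.injectivityOrder f V < ⊤) ∧
    (IsAlgClosed k → (∀ x : X, Set.InjOn (TaylorMap.germ f M x) V) →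
      TaylorMap.IsSeparatedSubspace f V) :=
  ⟨fun _ hV => TaylorMap.injectivityOrder_lt_top f V hM hV,
    fun _ hV x => TaylorMap.isSeparatedAt_of_injOn_germ f V hM x (hV x)⟩
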